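/- Let $m\ge 2$, let $dV$ be the surface measure of the unit sphere $S^{2m-1}\subset\mathbb C^m$ normalized to total mass $1$, and let $H^2(S^{2m-1})\subset L^2(S^{2m-1},dV)$ be the Hardy space (the closure of the holomorphic polynomials). Conventions. For a bounded operator $T$ let $\mu_0(T)\ge\mu_1(T)\ge\dots$ be its singular values; for $1\le p<\infty$ let $\mathcal L^{p,\infty}$ be the set of compact $T$ with $\mu_k(T)\le C(1+k)^{-1/p}$ for some $C$ and all $k\ge0$; let $\mathcal L^{\infty,\infty}$ be the set of all bounded operators. An extended limit $\omega$ is a state on $\ell^\infty(\mathbb N)$ vanishing on $c_0(\mathbb N)$; write $\lim_{N\to\omega}c_N=\omega(c)$. The Dixmier trace $\mathrm{tr}_\omega$ is the linear extension to $\mathcal L^{1,\infty}$ of $T\mapsto\lim_{N\to\omega}\frac1{\log N}\sum_{k=0}^N\mu_k(T)$, $T\ge0$. Let $\Delta_K=-\sum_{j<k}(M_{jk}\bar M_{jk}+\bar M_{jk}M_{jk})$, with $M_{jk}=\bar z_j\partial_{z_k}-\bar z_k\partial_{z_j}$, be the non-negative Kohn sub-Laplacian. A bounded operator $G$ on $H^2(S^{2m-1})$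 is weakly sub-Laplacian modulated if for some $s>0$ the operator $V=(1+\Delta_K)^{-s}$ on $H^2(S^{2m-1})$ is positive with dense range and there is $p\in[1,\infty)$ such that $V\in\mathcal L^{p,\infty}$ and the densely defined operator $GV^{-1}$ extends to an operator in $\mathcal L^{p/(p-1),\infty}$. A kernel of $G$ is a $k_G\in L^2(S^{2m-1}\times S^{2m-1})$ with $(Gf)(z)=\int k_G(z,w)f(w)\,dV(w)$ for all $f\in H^2(S^{2m-1})$. For $N\ge 0$ put $$h_N(t)=\frac{(-1)^{m-1}}{m!}\,\frac{d^{m-1}}{dt^{m-1}}\,\frac{1-(1-t)^{N+m}}{t}$$ (the quotient being the polynomial $\sum_{j=0}^{N+m-1}(1-t)^j$). Theorem. Let $G\in\mathcal L^{1,\infty}(H^2(S^{2m-1}))$ be weakly sub-Laplacian modulated with kernel $k_G$, and let $\omega$ be an extended limit. Then the sequence on the right-hand side is bounded and $$\mathrm{tr}_\omega(G)=\lim_{N\to\omega}\frac{m}{\log N}\int_{S^{2m-1}\times S^{2m-1}}k_G(z,w)\,h_{\lfloor N^{1/m}\rfloor}(1-\bar z\cdot w)\,dV(z)\,dV(w),\qquad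 \bar z\cdot w=\sum_i\bar z_iw_i .$$ Moreover the sequence $\frac1{\log N}\int\!\!\int k_G(z,w)h_N(1-\bar z\cdot w)\,dV\,dV$ is bounded, and if $\omega$ satisfies $\lim_{N\to\omega}a_{N^m}=\lim_{N\to\omega}a_N$ for all $a\in\ell^\infty(\mathbb N)$, then $$\mathrm{tr}_\omega(G)=\lim_{N\to\omega}\frac1{\log N}\int_{S^{2m-1}\times S^{2m-1}}k_G(z,w)\,h_N(1-\bar z\cdot w)\,dV(z)\,dV(w).$$ (The finitely many terms with $N\le 1$, where $1/\log N$ is not defined, may be given any value; they do not affect the limits.) -/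

import Mathlib

open MeasureTheory Filter Topology
open scoped ENNReal

/-! ### Extended limits, weak Schatten ideals, Dixmier traces -/

/-- The Banach algebra `ℓ^∞(ℕ)` of bounded complex sequences. -/
abbrev EllInfty : Type := lp (fun _ : ℕ => ℂ) ∞

/-- An extended limit: a state on `ℓ^∞(ℕ)` (a positive functional with value `1` at the constant
sequence `1`) that vanishes on `c₀(ℕ)`. -/
structure IsExtendedLimit (ω : EllInfty →L[ℂ] ℂ) : Prop where
  map_one : ω 1 = 1
  nonneg : ∀ a : EllInfty, (∀ n, 0 ≤ (a n).re ∧ (a n).im = 0) → 0 ≤ (ω a).re ∧ (ω a).im = 0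
  singular : ∀ a : EllInfty, Tendsto (fun n => a n) atTop (𝓝 0) → ω a = 0

/-- The invariance `lim_{N → ω} a_{N ^ m} = lim_{N → ω} a_N` for all bounded sequences. -/
def IsPowInvariant (m : ℕ) (ω : EllInfty →L[ℂ] ℂ) : Prop :=
  ∀ a b : EllInfty, (∀ N, b N = a (N ^ m)) → ω b = ω a

open Classical in
/-- `lim_{N → ω} c_N`, with the value `0` for unbounded sequences. -/
noncomputable def omegaLim (ω : EllInfty →L[ℂ] ℂ) (c : ℕ → ℂ) : ℂ :=
  if h : Memℓp c ∞ then ω ⟨c, h⟩ else 0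

section Operators

variable {H : Type*} [NormedAddCommGroup H] [InnerProductSpace ℂ H]

/-- The singular values `μ_k(T)`, `k = 0, 1, 2, …`, of a bounded operator, as the distance of `T`
to the operators of rank at most `k`. For a compact operator they are the eigenvalues of `|T|`
in decreasing order, with multiplicity. -/
noncomputable def singVal (k : ℕ) (T : H →L[ℂ] H) : ℝ :=
  sInf {r : ℝ | ∃ F : H →L[ℂ] H, F.toLinearMap.rank ≤ (k : Cardinal) ∧ r = ‖T - F‖}

/-- The weak Schatten ideal `𝓛^{p,∞}(H)`, for `1 ≤ p < ∞`. -/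
def IsWeakSchatten (p : ℝ) (T : H →L[ℂ] H) : Prop :=
  IsCompactOperator T ∧ ∃ C : ℝ, ∀ k : ℕ, singVal k T ≤ C * (1 + (k : ℝ)) ^ (-(1 / p))

variable [CompleteSpace H]

/-- The Dixmier trace on positive operators: `lim_{N → ω} (∑_{k ≤ N} μ_k(T)) / log N`. -/
noncomputable def dixmierTracePos (ω : EllInfty →L[ℂ] ℂ) (T : H →L[ℂ] H) : ℂ :=
  omegaLim ω fun N => (((∑ k ∈ Finset.range (N + 1), singVal k T) / Real.log N : ℝ) : ℂ)

/-- The Dixmier trace `tr_ω` on `𝓛^{1,∞}(H)`: the value at `G` of the linear extension from the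
positive operators, through `G = (Re G)₊ - (Re G)₋ + i ((Im G)₊ - (Im G)₋)`. -/
noncomputable def dixmierTrace (ω : EllInfty →L[ℂ] ℂ) (G : H →L[ℂ] H) : ℂ :=
  (dixmierTracePos ω ((realPart G : H →L[ℂ] H)⁺) - dixmierTracePos ω ((realPart G : H →L[ℂ] H)⁻))
    + Complex.I * (dixmierTracePos ω ((imaginaryPart G : H →L[ℂ] H)⁺)
      - dixmierTracePos ω ((imaginaryPart G : H →L[ℂ] H)⁻))

/-- The real power `T ^ s` of a positive operator, by the continuous functional calculus. -/
noncomputable def opPow (T : H →L[ℂ] H) (s : ℝ) : H →L[ℂ] H := CFC.rpow T s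

/-- `G` is weakly `V`-modulated: `V` is strictly positive (positive with dense range) and lies in
`𝓛^{p,∞}` for some `1 ≤ p < ∞`, and the densely defined operator `G V⁻¹` extends to a bounded
operator `A` in `𝓛^{p/(p-1),∞}`. For `p = 1` the latter is the algebra of bounded operators. -/
def IsWeaklyModulated (V G : H →L[ℂ] H) : Prop :=
  V.IsPositive ∧ DenseRange V ∧
    ∃ p : ℝ, 1 ≤ p ∧ IsWeakSchatten p V ∧
      ∃ A : H →L[ℂ] H, (∀ x, A (V x) = G x) ∧ (1 < p → IsWeakSchatten (p / (p - 1)) A)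

end Operators

/-! ### The unit sphere of `ℂ^m`, its Hardy space, and the Kohn sub-Laplacian -/

/-- Complex Euclidean space `ℂ^m`. -/
abbrev CSpace (m : ℕ) : Type := EuclideanSpace ℂ (Fin m)

/-- The unit sphere `S^{2m-1}` of `ℂ^m`. -/
abbrev CSphere (m : ℕ) : Type := Metric.sphere (0 : CSpace m) 1

/-- The surface measure `dV` of `S^{2m-1}`, normalized to total mass `1`. -/
noncomputable def sphereVol (m : ℕ) : Measure (CSphere m) :=
  ((volume : Measure (CSpace m)).toSphere Set.univ)⁻¹ • (volume : Measure (CSpace m)).toSphere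

noncomputable instance sphereVol_isFiniteMeasure (m : ℕ) : IsFiniteMeasure (sphereVol m) := by
  constructor
  rw [sphereVol, Measure.smul_apply, smul_eq_mul]
  exact lt_of_le_of_lt (ENNReal.inv_mul_le_one _) ENNReal.one_lt_top

/-- The holomorphic coordinate `z_i` as a continuous function on the sphere. -/
def sphereCoord (m : ℕ) (i : Fin m) : C(CSphere m, ℂ) where
  toFun z := (z : CSpace m) i
  continuous_toFun := by fun_prop

/-- Restriction of holomorphic polynomials to the sphere. -/
noncomputable def polyRestrict (m : ℕ) : MvPolynomial (Fin m) ℂ →ₐ[ℂ] C(CSphere m, ℂ) :=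
  MvPolynomial.aeval (sphereCoord m)

/-- The Hardy space `H²(S^{2m-1})`: the closure in `L²(S^{2m-1})` of the restrictions of the
holomorphic polynomials. -/
noncomputable def hardySpace (m : ℕ) : Submodule ℂ (Lp ℂ 2 (sphereVol m)) :=
  (LinearMap.range ((ContinuousMap.toLp 2 (sphereVol m) ℂ :
    C(CSphere m, ℂ) →L[ℂ] Lp ℂ 2 (sphereVol m)).toLinearMap ∘ₗ
      (polyRestrict m).toLinearMap)).topologicalClosure

noncomputable instance hardySpace_completeSpace (m : ℕ) : CompleteSpace (hardySpace m) :=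
  (Submodule.isClosed_topologicalClosure _).completeSpace_coe

/-- The Wirtinger derivative `∂f/∂z_j = (∂f/∂x_j - i ∂f/∂y_j) / 2`. -/
noncomputable def dz {m : ℕ} (j : Fin m) (f : CSpace m → ℂ) (z : CSpace m) : ℂ :=
  (fderiv ℝ f z (EuclideanSpace.single j 1)
    - Complex.I * fderiv ℝ f z (EuclideanSpace.single j Complex.I)) / 2

/-- The Wirtinger derivative `∂f/∂z̄_j = (∂f/∂x_j + i ∂f/∂y_j) / 2`. -/
noncomputable def dzbar {m : ℕ} (j : Fin m) (f : CSpace m → ℂ) (z : CSpace m) : ℂ :=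
  (fderiv ℝ f z (EuclideanSpace.single j 1)
    + Complex.I * fderiv ℝ f z (EuclideanSpace.single j Complex.I)) / 2

/-- The horizontal vector field `M_{jk} = z̄_j ∂/∂z_k - z̄_k ∂/∂z_j`, tangent to the sphere. -/
noncomputable def tangM {m : ℕ} (j k : Fin m) (f : CSpace m → ℂ) (z : CSpace m) : ℂ :=
  star (z j) * dz k f z - star (z k) * dz j f z

/-- The conjugate vector field `M̄_{jk} = z_j ∂/∂z̄_k - z_k ∂/∂z̄_j`. -/
noncomputable def tangMbar {m : ℕ} (j k : Fin m) (f : CSpace m → ℂ) (z : CSpace m) : ℂ :=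
  z j * dzbar k f z - z k * dzbar j f z

/-- The (non-negative) Kohn sub-Laplacian
`Δ_K = - ∑_{j < k} (M_{jk} M̄_{jk} + M̄_{jk} M_{jk})`. -/
noncomputable def kohnLaplacian {m : ℕ} (f : CSpace m → ℂ) (z : CSpace m) : ℂ :=
  -∑ j : Fin m, ∑ k ∈ Finset.Ioi j, (tangM j k (tangMbar j k f) z + tangMbar j k (tangM j k f) z)

/-- A holomorphic polynomial as a function on `ℂ^m`. -/
noncomputable def polyFun {m : ℕ} (p : MvPolynomial (Fin m) ℂ) (z : CSpace m) : ℂ :=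
  MvPolynomial.eval (fun i => z i) p

/-- `R` is the resolvent `(1 + Δ_K)⁻¹` on `H²(S^{2m-1})`: the positive bounded operator with
`R ((1 + Δ_K) f) = f` for every holomorphic polynomial `f`. As `Δ_K` is essentially self-adjoint
on the holomorphic polynomials, this determines `R`. -/
def IsSubLaplacianResolvent (m : ℕ) (R : hardySpace m →L[ℂ] hardySpace m) : Prop :=
  R.IsPositive ∧
    ∀ (p : MvPolynomial (Fin m) ℂ) (u v : hardySpace m),
      (⇑(u : Lp ℂ 2 (sphereVol m)) =ᵐ[sphereVol m]
        fun z => polyFun p (z : CSpace m) + kohnLaplacian (polyFun p) (z : CSpace m)) →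
      (⇑(v : Lp ℂ 2 (sphereVol m)) =ᵐ[sphereVol m] fun z => polyFun p (z : CSpace m)) →
      R u = v

/-- `G` is weakly sub-Laplacian modulated: weakly modulated with respect to a negative power
`V = (1 + Δ_K)^{-s}`, `s > 0`. -/
def IsWeaklySubLaplacianModulated (m : ℕ) (G : hardySpace m →L[ℂ] hardySpace m) : Prop :=
  ∃ R : hardySpace m →L[ℂ] hardySpace m, IsSubLaplacianResolvent m R ∧
    ∃ s : ℝ, 0 < s ∧ IsWeaklyModulated (opPow R s) G

/-- `k ∈ L²(S^{2m-1} × S^{2m-1})` is an integral kernel of the operator `G` on `H²(S^{2m-1})`: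
`(G f)(z) = ∫ k(z, w) f(w) dV(w)`. -/
def IsKernelOf {m : ℕ} (k : CSphere m × CSphere m → ℂ)
    (G : hardySpace m →L[ℂ] hardySpace m) : Prop :=
  MemLp k 2 ((sphereVol m).prod (sphereVol m)) ∧
    ∀ f : hardySpace m, ⇑(G f : Lp ℂ 2 (sphereVol m)) =ᵐ[sphereVol m]
      fun z => ∫ w, k (z, w) * (f : Lp ℂ 2 (sphereVol m)) w ∂(sphereVol m)

/-- The truncated geometric series `∑_{j < N + m} (1 - t)^j`, that is, the polynomial
`(1 - (1 - t)^{N + m}) / t`. -/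
noncomputable def geomTrunc (m N : ℕ) (t : ℂ) : ℂ :=
  ∑ j ∈ Finset.range (N + m), (1 - t) ^ j

theorem geomTrunc_eq_div (m N : ℕ) {t : ℂ} (ht : t ≠ 0) :
    geomTrunc m N t = (1 - (1 - t) ^ (N + m)) / t := by
  have h : (1 - t : ℂ) ≠ 1 := fun h => ht (by linear_combination -h)
  rw [geomTrunc, geom_sum_eq h, ← neg_div_neg_eq]
  congr 1 <;> ring

/-- `h_N(t) = ((-1)^{m-1} / m!) d^{m-1}/dt^{m-1} ((1 - (1 - t)^{N + m}) / t)`. -/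
noncomputable def hFun (m N : ℕ) (t : ℂ) : ℂ :=
  (-1) ^ (m - 1) / (m.factorial : ℂ) * iteratedDeriv (m - 1) (geomTrunc m N) t

/-- The double integral `∫∫ k(z, w) h_N(1 - z̄ · w) dV(z) dV(w)`. -/
noncomputable def kernelPairing {m : ℕ} (k : CSphere m × CSphere m → ℂ) (N : ℕ) : ℂ :=
  ∫ x, k x * hFun m N (1 - ∑ i, star ((x.1 : CSpace m) i) * (x.2 : CSpace m) i)
    ∂((sphereVol m).prod (sphereVol m))

/-! The double integral is a trace. By the multinomial theorem, `h_n(1 - z̄·w)` is `1/m` times the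
reproducing kernel of the polynomials of degree at most `n`. With `P_n` the projection onto these
polynomials, pairing with the kernel of `G` therefore gives `Tr(P_n G) / m` (`kernelPairing_eq`). On
a monomial `z ^ α` the Kohn sub-Laplacian is multiplication by `(m - 1)|α|`, so `P_n` is also a
spectral projection of `V = (1 + Δ_K)^{-s}`, and its rank is comparable with `n ^ m`. For `n =
⌊N^{1/m}⌋` the rank is comparable with `N`.

It remains to see that `Tr(P_n G)` differs by `O(1)` from the signed sum of the first `N + 1`
singular values of the four positive parts of `G`; after division by `log N` an extended limit does
not see the difference. Let `Q` project onto the span of the top eigenvectors of these parts, so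
that `Q` has rank `O(N)` and `Tr(Q G)` is that sum up to `O(1)`. Then `Tr(P G) - Tr(Q G) = Tr(P(1 -
Q)G) - Tr(Q G(1 - P))`. The first term is at most `rank P · ‖(1 - Q)G‖ = O(N · 1/N)`. In the second,
`G(1 - P) = A V(1 - P)` with `A` in the weak ideal of exponent `p/(p - 1)`. A dyadic decomposition
of `A` (`exists_norm_sum_inner_le`) bounds the term by `O(N^{1/p}) ‖V(1 - P)‖`, and the norm is
`O(N^{-1/p})` because `V` lies in the weak ideal of exponent `p`. The abstract estimate is
`exists_norm_diagonal_sub_le`; its application to the sphere is `exists_norm_sum_degreeLE_sub_le`.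

The second formula is the first one read along the subsequence `N ^ m`. -/

/-! ### Approximation numbers -/

section SingularValues

variable {H : Type*} [NormedAddCommGroup H] [InnerProductSpace ℂ H]

theorem singVal_bddBelow (k : ℕ) (T : H →L[ℂ] H) :
    BddBelow {r : ℝ | ∃ F : H →L[ℂ] H, F.toLinearMap.rank ≤ (k : Cardinal) ∧ r = ‖T - F‖} :=
  ⟨0, by rintro _ ⟨F, -, rfl⟩; exact norm_nonneg _⟩

theorem singVal_nonempty (k : ℕ) (T : H →L[ℂ] H) :
    {r : ℝ | ∃ F : H →L[ℂ] H, F.toLinearMap.rank ≤ (k : Cardinal) ∧ r = ‖T - F‖}.Nonempty :=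
  ⟨‖T - 0‖, 0, by
    rw [show (0 : H →L[ℂ] H).toLinearMap = 0 from rfl, LinearMap.rank_zero]; exact zero_le, rfl⟩

theorem singVal_le_norm_sub {k : ℕ} {T F : H →L[ℂ] H}
    (hF : F.toLinearMap.rank ≤ (k : Cardinal)) : singVal k T ≤ ‖T - F‖ :=
  csInf_le (singVal_bddBelow k T) ⟨F, hF, rfl⟩

theorem le_singVal {k : ℕ} {T : H →L[ℂ] H} {a : ℝ}
    (h : ∀ F : H →L[ℂ] H, F.toLinearMap.rank ≤ (k : Cardinal) → a ≤ ‖T - F‖) :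
    a ≤ singVal k T :=
  le_csInf (singVal_nonempty k T) (by rintro _ ⟨F, hF, rfl⟩; exact h F hF)

theorem singVal_nonneg (k : ℕ) (T : H →L[ℂ] H) : 0 ≤ singVal k T :=
  le_singVal fun _ _ => norm_nonneg _

theorem singVal_anti {k l : ℕ} (h : k ≤ l) (T : H →L[ℂ] H) : singVal l T ≤ singVal k T :=
  le_singVal fun _ hF => singVal_le_norm_sub (hF.trans (by exact_mod_cast h))

theorem exists_rank_le_norm_sub_lt {k : ℕ} {T : H →L[ℂ] H} {r : ℝ} (h : singVal k T < r) :
    ∃ F : H →L[ℂ] H, F.toLinearMap.rank ≤ (k : Cardinal) ∧ ‖T - F‖ < r := by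
  obtain ⟨_, ⟨F, hF, rfl⟩, h'⟩ := exists_lt_of_csInf_lt (singVal_nonempty k T) h
  exact ⟨F, hF, h'⟩

theorem rank_add_le_nat {F F' : H →L[ℂ] H} {k l : ℕ}
    (hF : F.toLinearMap.rank ≤ (k : Cardinal)) (hF' : F'.toLinearMap.rank ≤ (l : Cardinal)) :
    (F + F').toLinearMap.rank ≤ ((k + l : ℕ) : Cardinal) := by
  push_cast
  exact (LinearMap.rank_add_le F.toLinearMap F'.toLinearMap).trans (add_le_add hF hF')

theorem rank_smul_le_nat {F : H →L[ℂ] H} {k : ℕ} (c : ℂ)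
    (hF : F.toLinearMap.rank ≤ (k : Cardinal)) :
    (c • F).toLinearMap.rank ≤ (k : Cardinal) := by
  refine le_trans ?_ hF
  have : (c • F).toLinearMap = F.toLinearMap ∘ₗ (c • LinearMap.id) := by
    ext x; simp
  rw [this]
  exact LinearMap.rank_comp_le_left _ _

theorem singVal_add_le (k l : ℕ) (S T : H →L[ℂ] H) :
    singVal (k + l) (S + T) ≤ singVal k S + singVal l T := by
  refine le_of_forall_pos_le_add fun ε hε => ?_
  obtain ⟨F, hF, h1⟩ := exists_rank_le_norm_sub_lt (lt_add_of_pos_right (singVal k S) (half_pos hε))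
  obtain ⟨F', hF', h2⟩ :=
    exists_rank_le_norm_sub_lt (lt_add_of_pos_right (singVal l T) (half_pos hε))
  have h := singVal_le_norm_sub (T := S + T) (rank_add_le_nat hF hF')
  have h3 : ‖S + T - (F + F')‖ ≤ ‖S - F‖ + ‖T - F'‖ := by
    rw [add_sub_add_comm]; exact norm_add_le _ _
  linarith

theorem singVal_smul_le (k : ℕ) (c : ℂ) (T : H →L[ℂ] H) :
    singVal k (c • T) ≤ ‖c‖ * singVal k T := by
  refine le_of_forall_pos_le_add fun ε hε => ?_
  have hc : 0 < ‖c‖ + 1 := by positivity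
  obtain ⟨F, hF, h1⟩ := exists_rank_le_norm_sub_lt
    (lt_add_of_pos_right (singVal k T) (div_pos hε hc))
  have h := singVal_le_norm_sub (T := c • T) (rank_smul_le_nat c hF)
  rw [← smul_sub, norm_smul] at h
  have h3 : ‖c‖ * ‖T - F‖ ≤ ‖c‖ * (singVal k T + ε / (‖c‖ + 1)) := by gcongr
  have h4 : ‖c‖ * (ε / (‖c‖ + 1)) ≤ ε := by
    rw [mul_div_assoc', div_le_iff₀ hc]; nlinarith
  linarith

/-- A map `F` of rank at most `k` kills some nonzero combination `x` of the `k + 1` eigenvectors,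
and there `‖(T - F) x‖ = ‖T x‖ ≥ a ‖x‖`. -/
theorem le_singVal_of_orthonormal_eigenvectors {k : ℕ} {T : H →L[ℂ] H} {e : Fin (k + 1) → H}
    (he : Orthonormal ℂ e) {c : Fin (k + 1) → ℂ} (hT : ∀ i, T (e i) = c i • e i) {a : ℝ}
    (ha : ∀ i, a ≤ ‖c i‖) : a ≤ singVal k T := by
  rcases lt_or_ge a 0 with h0 | h0
  · exact h0.le.trans (singVal_nonneg k T)
  refine le_singVal fun F hF => ?_
  have hdep : ¬ LinearIndependent ℂ fun i => F (e i) := by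
    intro hli
    have h1 : LinearIndependent ℂ
        fun i => (⟨F (e i), ⟨e i, rfl⟩⟩ : LinearMap.range F.toLinearMap) :=
      LinearIndependent.of_comp (LinearMap.range F.toLinearMap).subtype hli
    have h2 := h1.cardinal_lift_le_rank
    have h3 := h2.trans (Cardinal.lift_le.mpr hF)
    simp at h3
  obtain ⟨g, hg, i, hi⟩ := Fintype.not_linearIndependent_iff.mp hdep
  set x : H := ∑ j, g j • e j with hx
  have hnx (g : Fin (k + 1) → ℂ) : ‖∑ j, g j • e j‖ ^ 2 = ∑ j, ‖g j‖ ^ 2 := by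
    have h := he.inner_sum g g Finset.univ
    rw [← @inner_self_eq_norm_sq ℂ, h]
    simp [Complex.sq_norm, Complex.normSq_apply]
  have hFx : F x = 0 := by simpa [hx, map_sum] using hg
  have hTx : T x = ∑ j, (g j * c j) • e j := by
    simp [hx, map_sum, hT, smul_smul]
  have hxpos : 0 < ‖x‖ := by
    have : 0 < ‖x‖ ^ 2 := by
      rw [hx, hnx]
      exact Finset.sum_pos' (fun _ _ => by positivity) ⟨i, Finset.mem_univ _, by positivity⟩
    exact (sq_pos_iff.mp this).lt_of_le' (norm_nonneg _)
  have h1 : (a * ‖x‖) ^ 2 ≤ ‖T x‖ ^ 2 := by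
    rw [mul_pow, hTx, hx, hnx, hnx, Finset.mul_sum]
    refine Finset.sum_le_sum fun j _ => ?_
    rw [norm_mul, mul_pow, mul_comm]
    have := ha j
    gcongr
  have h2 : a * ‖x‖ ≤ ‖T x‖ := le_of_sq_le_sq h1 (norm_nonneg _)
  have h3 : ‖T x‖ ≤ ‖T - F‖ * ‖x‖ := by
    have := (T - F).le_opNorm x
    simpa [hFx] using this
  exact le_of_mul_le_mul_right (h2.trans h3) hxpos

theorem exists_unit_orthogonal (hinf : ¬ FiniteDimensional ℂ H) (U : Submodule ℂ H)
    [FiniteDimensional ℂ U] : ∃ x : H, ‖x‖ = 1 ∧ x ∈ Uᗮ := by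
  have : Uᗮ ≠ ⊥ := by
    intro h
    rw [Submodule.orthogonal_eq_bot_iff] at h
    subst h
    exact hinf (Module.Finite.equiv (Submodule.topEquiv (R := ℂ) (M := H)))
  obtain ⟨x, hx, hx0⟩ := Submodule.exists_mem_ne_zero_of_ne_bot this
  refine ⟨(‖x‖⁻¹ : ℂ) • x, ?_, Submodule.smul_mem _ _ hx⟩
  rw [norm_smul]
  simp [hx0]

theorem span_orthogonal_iff {ι : Type*} (e : ι → H) (y : H) :
    y ∈ (Submodule.span ℂ (Set.range e))ᗮ ↔ ∀ i, inner ℂ (e i) y = 0 := by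
  constructor
  · exact fun h i => h _ (Submodule.subset_span ⟨i, rfl⟩)
  · intro h u hu
    induction hu using Submodule.span_induction with
    | mem u hu => obtain ⟨i, rfl⟩ := hu; exact h i
    | zero => simp
    | add u v _ _ hu hv => simp [inner_add_left, hu, hv]
    | smul a u _ hu => simp [inner_smul_left, hu]

instance finiteDimensional_span_range {ι : Type*} [Finite ι] (e : ι → H) :
    FiniteDimensional ℂ (Submodule.span ℂ (Set.range e)) :=
  FiniteDimensional.span_of_finite ℂ (Set.finite_range e)

end SingularValues

/-! ### Spectral theorem for positive compact operators -/

section Spectral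

variable {H : Type*} [NormedAddCommGroup H] [InnerProductSpace ℂ H] [CompleteSpace H]

/-- One step of the diagonalization. The orthogonal complement of the eigenvectors already found is
invariant, and `ν` is the norm of the compression `S` of `T` to it. The norm of a positive operator
is in its spectrum, and nonzero spectrum of a compact operator consists of eigenvalues. If `S = 0`,
infinite dimension still provides a unit vector in the complement. -/
theorem exists_norm_eigenvector (hinf : ¬ FiniteDimensional ℂ H) {T : H →L[ℂ] H}
    (hT : IsCompactOperator T) (hpos : 0 ≤ T) {n : ℕ} {e : Fin n → H} {c : Fin n → ℂ}
    (hc : ∀ i, T (e i) = c i • e i) :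
    ∃ (ν : ℝ) (x : H), 0 ≤ ν ∧ ‖x‖ = 1 ∧ (∀ i, inner ℂ (e i) x = 0) ∧ T x = (ν : ℂ) • x ∧
      ∀ y, (∀ i, inner ℂ (e i) y = 0) → ‖T y‖ ≤ ν * ‖y‖ := by
  have hTs : T.IsPositive := (ContinuousLinearMap.nonneg_iff_isPositive T).mp hpos
  set K : Submodule ℂ H := Submodule.span ℂ (Set.range e)
  have : FiniteDimensional ℂ K := finiteDimensional_span_range e
  have hK (y : H) : y ∈ Kᗮ ↔ ∀ i, inner ℂ (e i) y = 0 := span_orthogonal_iff e y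
  have hinv (y : H) (hy : y ∈ Kᗮ) : T y ∈ Kᗮ := by
    rw [hK] at hy ⊢
    intro i
    rw [show inner ℂ (e i) (T y) = inner ℂ (T (e i)) y from
      (hTs.isSelfAdjoint.isSymmetric (e i) y).symm]
    simp [hc, hy i]
  set P := Kᗮ.starProjection
  set S : H →L[ℂ] H := P ∘L T ∘L P
  have hSpos : 0 ≤ S := by
    rw [ContinuousLinearMap.nonneg_iff_isPositive]
    exact hTs.conj_starProjection Kᗮ
  have hScomp : IsCompactOperator S := (hT.comp_clm P).clm_comp P
  have hST (y : H) (hy : y ∈ Kᗮ) : S y = T y := by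
    have h1 : P y = y := Submodule.starProjection_eq_self_iff.mpr hy
    have h2 : P (T y) = T y := Submodule.starProjection_eq_self_iff.mpr (hinv y hy)
    simp [S, h1, h2]
  have hbound (y : H) (hy : ∀ i, inner ℂ (e i) y = 0) : ‖T y‖ ≤ ‖S‖ * ‖y‖ := by
    rw [← hST y ((hK y).mpr hy)]
    exact S.le_opNorm y
  rcases eq_or_ne S 0 with hS0 | hS0
  · obtain ⟨x, hx1, hx2⟩ := exists_unit_orthogonal hinf K
    refine ⟨‖S‖, x, norm_nonneg _, hx1, (hK x).mp hx2, ?_, hbound⟩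
    rw [← hST x hx2, hS0]; simp
  · have : Nontrivial H := by
      by_contra h
      rw [not_nontrivial_iff_subsingleton] at h
      exact hS0 (Subsingleton.elim _ _)
    have hsp : ‖S‖ ∈ spectrum ℝ S := CStarAlgebra.norm_mem_spectrum_of_nonneg hSpos
    have hsp' : ((‖S‖ : ℝ) : ℂ) ∈ spectrum ℂ S := spectrum.algebraMap_mem ℂ hsp
    have hne : ((‖S‖ : ℝ) : ℂ) ≠ 0 := by simpa using hS0
    rw [← hScomp.hasEigenvalue_iff_mem_spectrum hne] at hsp'
    obtain ⟨x, hx, hx0⟩ := hsp'.exists_hasEigenvector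
    rw [Module.End.mem_eigenspace_iff] at hx
    change S x = _ at hx
    have hxK : x ∈ Kᗮ := by
      have : ((‖S‖ : ℝ) : ℂ) • x ∈ Kᗮ := by
        rw [← hx]; exact Submodule.starProjection_apply_mem _ _
      exact (Submodule.smul_mem_iff _ hne).mp this
    refine ⟨‖S‖, (‖x‖⁻¹ : ℂ) • x, norm_nonneg _, ?_, ?_, ?_, hbound⟩
    · rw [norm_smul]; simp [hx0]
    · exact (hK _).mp (Submodule.smul_mem _ _ hxK)
    · rw [map_smul, ← hST x hxK, hx, smul_comm]

/-- The eigenvalue found at stage `n` is the `n`-th approximation number: composing `T` with the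
projection onto the earlier eigenvectors approximates it from above (`hrank`), and the `n + 1`
orthonormal eigenvectors bound it from below (`hup`). -/
theorem exists_orthonormal_eigenvectors (hinf : ¬ FiniteDimensional ℂ H) {T : H →L[ℂ] H}
    (hT : IsCompactOperator T) (hpos : 0 ≤ T) (n : ℕ) :
    ∃ e : Fin n → H, Orthonormal ℂ e ∧ (∀ i, T (e i) = (singVal i T : ℂ) • e i) ∧
      ∀ y, (∀ i, inner ℂ (e i) y = 0) → ‖T y‖ ≤ singVal n T * ‖y‖ := by
  have hcons {n : ℕ} {e : Fin n → H} (he : Orthonormal ℂ e) {x : H} (hx : ‖x‖ = 1)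
      (hex : ∀ i, inner ℂ (e i) x = 0) : Orthonormal ℂ (Fin.snoc e x : Fin (n + 1) → H) := by
    constructor
    · intro i
      refine Fin.lastCases ?_ (fun i => ?_) i
      · simpa using hx
      · simpa using he.1 i
    · intro i j
      refine Fin.lastCases ?_ (fun i => ?_) i <;> refine Fin.lastCases ?_ (fun j => ?_) j
      · simp
      · intro _; simpa using inner_eq_zero_symm.mp (hex j)
      · intro _; simpa using hex i
      · intro hij; simpa using he.2 (fun h => hij (by rw [h]))
  have hrank {n : ℕ} {e : Fin n → H} (he : Orthonormal ℂ e)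
      (h : ∀ i, T (e i) = (singVal i T : ℂ) • e i) (ν : ℝ) (hν : 0 ≤ ν)
      (hb : ∀ y, (∀ i, inner ℂ (e i) y = 0) → ‖T y‖ ≤ ν * ‖y‖) : singVal n T ≤ ν := by
    set K : Submodule ℂ H := Submodule.span ℂ (Set.range e)
    have : FiniteDimensional ℂ K := finiteDimensional_span_range e
    have hr : (T ∘L K.starProjection).toLinearMap.rank ≤ (n : Cardinal) := by
      have h1 : (T ∘L K.starProjection).toLinearMap.rank ≤ K.starProjection.toLinearMap.rank := by
        refine le_trans ?_ (LinearMap.rank_comp_le_right K.starProjection.toLinearMap T.toLinearMap)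
        rfl
      refine h1.trans ?_
      have h2 : LinearMap.range K.starProjection.toLinearMap ≤ K := by
        rintro _ ⟨y, rfl⟩
        exact Submodule.starProjection_apply_mem _ _
      refine (Submodule.rank_mono h2).trans ?_
      refine (rank_span_le _).trans ?_
      have := Cardinal.mk_range_le_lift (f := e)
      simpa using this
    refine (singVal_le_norm_sub hr).trans (ContinuousLinearMap.opNorm_le_bound _ hν fun y => ?_)
    have hy : y - K.starProjection y ∈ Kᗮ := Submodule.sub_starProjection_mem_orthogonal y
    have h3 := hb (y - K.starProjection y)
      (fun i => hy _ (Submodule.subset_span ⟨i, rfl⟩))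
    have h4 : ‖y - K.starProjection y‖ ≤ ‖y‖ := by
      rw [← Submodule.starProjection_orthogonal_val]
      exact Submodule.norm_starProjection_apply_le _ _
    calc ‖(T - T ∘L K.starProjection) y‖ = ‖T (y - K.starProjection y)‖ := by simp
      _ ≤ ν * ‖y - K.starProjection y‖ := h3
      _ ≤ ν * ‖y‖ := by gcongr
  have hup {n : ℕ} {e : Fin n → H} (he : Orthonormal ℂ e)
      (h : ∀ i, T (e i) = (singVal i T : ℂ) • e i) (ν : ℝ) (x : H) (hν : 0 ≤ ν) (hx : ‖x‖ = 1)
      (hex : ∀ i, inner ℂ (e i) x = 0) (hTx : T x = (ν : ℂ) • x)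
      (hle : ∀ i : Fin n, ν ≤ singVal i T) : ν ≤ singVal n T := by
    refine le_singVal_of_orthonormal_eigenvectors (hcons he hx hex)
      (c := Fin.snoc (fun i : Fin n => (singVal i T : ℂ)) (ν : ℂ)) ?_ ?_
    · intro i
      refine Fin.lastCases ?_ (fun i => ?_) i
      · simpa using hTx
      · simpa using h i
    · intro i
      refine Fin.lastCases ?_ (fun i => ?_) i
      · simp [abs_of_nonneg hν]
      · simpa using (hle i).trans (le_abs_self _)
  induction n with
  | zero =>
    refine ⟨Fin.elim0, ⟨fun i => i.elim0, fun i => i.elim0⟩, fun i => i.elim0, fun y _ => ?_⟩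
    obtain ⟨ν, x, hν, hx, hex, hTx, hb⟩ := exists_norm_eigenvector hinf hT hpos
      (e := Fin.elim0) (c := Fin.elim0) (fun i => i.elim0)
    have := hup (e := Fin.elim0) ⟨fun i => i.elim0, fun i => i.elim0⟩ (fun i => i.elim0) ν x hν hx
      hex hTx (fun i => i.elim0)
    exact (hb y fun i => i.elim0).trans (by gcongr)
  | succ n ih =>
    obtain ⟨e, he, hTe, hbe⟩ := ih
    obtain ⟨ν, x, hν, hx, hex, hTx, hb⟩ := exists_norm_eigenvector hinf hT hpos hTe
    have h1 : ν ≤ singVal n T := by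
      have := hbe x hex
      rw [hTx, norm_smul, hx] at this
      simpa [abs_of_nonneg hν] using this
    have h2 : ν = singVal n T := le_antisymm h1 (hrank he hTe ν hν hb)
    have he' := hcons he hx hex
    have hTe' : ∀ i : Fin (n + 1), T ((Fin.snoc e x : Fin (n + 1) → H) i) =
        (singVal i T : ℂ) • (Fin.snoc e x : Fin (n + 1) → H) i := by
      intro i
      refine Fin.lastCases ?_ (fun i => ?_) i
      · simpa [h2] using hTx
      · simpa using hTe i
    refine ⟨_, he', hTe', fun y hy => ?_⟩
    -- The norm bound off the enlarged family needs the next eigenvalue `ν'` as well, which `hup`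
    -- places below `singVal (n + 1) T`.
    obtain ⟨ν', x', hν', hx', hex', hTx', hb'⟩ := exists_norm_eigenvector hinf hT hpos hTe'
    have h3 : ν' ≤ singVal n T := by
      have := hbe x' (fun i => by simpa using hex' i.castSucc)
      rw [hTx', norm_smul, hx'] at this
      simpa [abs_of_nonneg hν'] using this
    have h4 := hup he' hTe' ν' x' hν' hx' hex' hTx'
      (fun i => h3.trans (singVal_anti (Nat.lt_succ_iff.mp i.2) T))
    exact (hb' y hy).trans (by gcongr)

end Spectral

/-! ### Ideal bounds for adjoints, real parts and positive parts -/

section PositivePart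

variable {H : Type*} [NormedAddCommGroup H] [InnerProductSpace ℂ H]

theorem finiteDimensional_range_of_rank_le {F : H →L[ℂ] H} {k : ℕ}
    (hF : F.toLinearMap.rank ≤ (k : Cardinal)) :
    FiniteDimensional ℂ (LinearMap.range F.toLinearMap) :=
  Module.rank_lt_aleph0_iff.mp (hF.trans_lt Cardinal.natCast_lt_aleph0)

theorem finrank_range_le_of_rank_le {F : H →L[ℂ] H} {k : ℕ}
    (hF : F.toLinearMap.rank ≤ (k : Cardinal)) :
    Module.finrank ℂ (LinearMap.range F.toLinearMap) ≤ k :=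
  Module.finrank_le_of_rank_le hF

theorem isCompactOperator_of_rank_le {F : H →L[ℂ] H} {k : ℕ}
    (hF : F.toLinearMap.rank ≤ (k : Cardinal)) : IsCompactOperator F := by
  have := finiteDimensional_range_of_rank_le hF
  have h1 : (LinearMap.range F.toLinearMap).subtypeL ∘L
      F.codRestrict (LinearMap.range F.toLinearMap) (fun x => ⟨x, rfl⟩) = F := by
    ext x; simp
  have : ProperSpace (LinearMap.range F.toLinearMap) := FiniteDimensional.proper ℂ _
  rw [← h1]
  have h2 : IsCompactOperator (LinearMap.range F.toLinearMap).subtypeL :=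
    isCompactOperator_id.clm_comp (LinearMap.range F.toLinearMap).subtypeL
  exact h2.comp_clm (F.codRestrict (LinearMap.range F.toLinearMap) (fun x => ⟨x, rfl⟩))

variable [CompleteSpace H]

/-- With `P` the projection onto the range of `F`, `F = P F` gives `F* = F* P`. -/
theorem rank_star_le {F : H →L[ℂ] H} {k : ℕ} (hF : F.toLinearMap.rank ≤ (k : Cardinal)) :
    (star F).toLinearMap.rank ≤ (k : Cardinal) := by
  have := finiteDimensional_range_of_rank_le hF
  set P := (LinearMap.range F.toLinearMap).starProjection
  have h1 : P ∘L F = F := by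
    ext x
    exact Submodule.starProjection_eq_self_iff.mpr ⟨x, rfl⟩
  have h2 : star F = star F ∘L P := by
    conv_lhs => rw [← h1]
    rw [← ContinuousLinearMap.mul_def, star_mul,
      (isSelfAdjoint_starProjection (LinearMap.range F.toLinearMap)).star_eq,
      ContinuousLinearMap.mul_def]
  have h3 : (star F ∘L P).toLinearMap.rank ≤ P.toLinearMap.rank := by
    refine le_trans ?_ (LinearMap.rank_comp_le_right P.toLinearMap (star F).toLinearMap)
    rfl
  rw [h2]
  refine h3.trans (le_trans (Submodule.rank_mono ?_) hF)
  rintro _ ⟨y, rfl⟩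
  exact Submodule.starProjection_apply_mem _ _

theorem singVal_star_le (k : ℕ) (T : H →L[ℂ] H) : singVal k (star T) ≤ singVal k T := by
  refine le_singVal fun F hF => (singVal_le_norm_sub (rank_star_le hF)).trans ?_
  rw [← star_sub, norm_star]

theorem isCompactOperator_of_singVal_le {T : H →L[ℂ] H} {C : ℝ}
    (h : ∀ k : ℕ, singVal k T ≤ C / (1 + k)) : IsCompactOperator T := by
  have hlim : Tendsto (fun k : ℕ => C / (1 + (k : ℝ))) atTop (𝓝 0) :=
    tendsto_const_nhds.div_atTop (tendsto_atTop_add_const_left _ _ tendsto_natCast_atTop_atTop)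
  have hcl : IsClosed {f : H →L[ℂ] H | IsCompactOperator f} := isClosed_setOfPred_isCompactOperator
  refine hcl.closure_subset (Metric.mem_closure_iff.mpr fun ε hε => ?_)
  obtain ⟨k, hk⟩ := (hlim.eventually (gt_mem_nhds hε)).exists
  obtain ⟨F, hF, hlt⟩ := exists_rank_le_norm_sub_lt ((h k).trans_lt hk)
  exact ⟨F, isCompactOperator_of_rank_le hF, by rwa [dist_eq_norm]⟩

/-- The function `x⁺` is uniformly within `ε / 2` of `x g(x)` with `g(x) = x⁺ / (|x| + ε / 2)`
continuous, and `B g(B)` is compact with `B`. Compact operators are norm closed. -/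
theorem isCompactOperator_posPart {B : H →L[ℂ] H} (hB : IsSelfAdjoint B)
    (hc : IsCompactOperator B) : IsCompactOperator (B⁺ : H →L[ℂ] H) := by
  have hcl : IsClosed {f : H →L[ℂ] H | IsCompactOperator f} := isClosed_setOfPred_isCompactOperator
  refine hcl.closure_subset (Metric.mem_closure_iff.mpr fun ε hε => ?_)
  have hε2 : 0 < ε / 2 := half_pos hε
  have hne (x : ℝ) : |x| + ε / 2 ≠ 0 := by positivity
  have hg : Continuous fun x : ℝ => x⁺ / (|x| + ε / 2) := by
    simp only [posPart_def]
    exact (continuous_id.sup continuous_const).div (by fun_prop) hne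
  have hp : Continuous fun x : ℝ => x⁺ := by
    simp only [posPart_def]
    exact continuous_id.sup continuous_const
  refine ⟨B * cfc (fun x : ℝ => x⁺ / (|x| + ε / 2)) B, hc.comp_clm _, ?_⟩
  have h1 : (B⁺ : H →L[ℂ] H) = cfc (fun x : ℝ => x⁺) B := by
    rw [CFC.posPart_def, cfcₙ_eq_cfc (hf := hp.continuousOn) (hf0 := by simp)]
  have h2 : B * cfc (fun x : ℝ => x⁺ / (|x| + ε / 2)) B =
      cfc (fun x : ℝ => x * (x⁺ / (|x| + ε / 2))) B := by
    rw [cfc_mul (fun x : ℝ => x) _ B (by fun_prop) hg.continuousOn, cfc_id' ℝ B]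
  rw [dist_eq_norm, h1, h2, ← cfc_sub _ _ B hp.continuousOn (by fun_prop)]
  refine lt_of_le_of_lt (norm_cfc_le hε2.le fun x _ => ?_) (half_lt_self hε)
  have hx : x * x⁺ = |x| * x⁺ := by
    rcases le_total 0 x with h | h
    · rw [abs_of_nonneg h]
    · simp [posPart_eq_zero.mpr h]
  have h3 : x⁺ - x * (x⁺ / (|x| + ε / 2)) = x⁺ * (ε / 2) / (|x| + ε / 2) := by
    have := hne x
    field_simp
    linear_combination -2 * hx
  have h4 : 0 ≤ x⁺ := posPart_nonneg x
  have h5 : x⁺ ≤ |x| := by rw [posPart_def]; exact sup_le (le_abs_self x) (abs_nonneg x)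
  rw [h3, Real.norm_eq_abs, abs_of_nonneg (by positivity), div_le_iff₀ (by positivity)]
  nlinarith [abs_nonneg x]

/-- Since `B⁻ B⁺ = 0`, an eigenvector of `B⁺` with nonzero eigenvalue is killed by `B⁻`, hence is an
eigenvector of `B` with the same eigenvalue. -/
theorem singVal_posPart_le (hinf : ¬ FiniteDimensional ℂ H) {B : H →L[ℂ] H}
    (hB : IsSelfAdjoint B) (hc : IsCompactOperator B) (k : ℕ) :
    singVal k (B⁺ : H →L[ℂ] H) ≤ singVal k B := by
  obtain ⟨e, he, hTe, -⟩ := exists_orthonormal_eigenvectors hinf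
    (isCompactOperator_posPart hB hc) (CFC.posPart_nonneg B) (k + 1)
  rcases (singVal_nonneg k (B⁺ : H →L[ℂ] H)).eq_or_lt with h0 | h0
  · rw [← h0]; exact singVal_nonneg _ _
  have hge (i : Fin (k + 1)) : singVal k (B⁺ : H →L[ℂ] H) ≤ singVal i (B⁺ : H →L[ℂ] H) :=
    singVal_anti (Nat.lt_succ_iff.mp i.2) _
  refine le_singVal_of_orthonormal_eigenvectors he
    (c := fun i => (singVal i (B⁺ : H →L[ℂ] H) : ℂ)) (fun i => ?_) (fun i => ?_)
  · have hneg : (B⁻ : H →L[ℂ] H) (e i) = 0 := by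
      have h1 : ((B⁻ : H →L[ℂ] H) * (B⁺ : H →L[ℂ] H)) (e i) = 0 := by
        rw [CFC.negPart_mul_posPart]; rfl
      rw [mul_apply_eq_comp, hTe, map_smul] at h1
      exact (smul_eq_zero.mp h1).resolve_left
        (by exact_mod_cast (h0.trans_le (hge i)).ne')
    conv_lhs => rw [← CFC.posPart_sub_negPart B hB]
    rw [sub_apply, hneg, sub_zero, hTe]
  · simpa using (hge i).trans (le_abs_self _)

/-- The rank `k` is shared equally between `G` and its adjoint; the factor `2` comes from `1 + k ≤ 2
(1 + ⌊k / 2⌋)`. -/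
theorem singVal_realPart_le {G : H →L[ℂ] H} {C : ℝ} (h : ∀ k : ℕ, singVal k G ≤ C / (1 + k))
    (k : ℕ) : singVal k (realPart G : H →L[ℂ] H) ≤ 2 * C / (1 + k) := by
  have hC : 0 ≤ C := by simpa using (singVal_nonneg 0 G).trans (h 0)
  have h1 : (realPart G : H →L[ℂ] H) = (1 / 2 : ℂ) • G + (1 / 2 : ℂ) • star G := by
    rw [realPart_apply_coe, ← smul_add]
    rw [← Complex.coe_smul]; norm_num
  have h2 : ‖(1 / 2 : ℂ)‖ = 1 / 2 := by simp
  have h3 := singVal_add_le (k / 2) (k / 2) ((1 / 2 : ℂ) • G) ((1 / 2 : ℂ) • star G)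
  have h4 := singVal_smul_le (k / 2) (1 / 2) G
  have h5 := singVal_smul_le (k / 2) (1 / 2) (star G)
  have h6 := singVal_star_le (k / 2) G
  have h7 := h (k / 2)
  have h8 : singVal k (realPart G : H →L[ℂ] H) ≤ C / (1 + (k / 2 : ℕ)) := by
    refine (singVal_anti (show k / 2 + k / 2 ≤ k by omega) _).trans ?_
    rw [h1]
    rw [h2] at h4 h5
    linarith
  refine h8.trans ?_
  rw [div_le_div_iff₀ (by positivity) (by positivity)]
  have h9 : (1 + k : ℝ) ≤ 2 * (1 + (k / 2 : ℕ)) := by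
    have : 1 + k ≤ 2 * (1 + k / 2) := by omega
    exact_mod_cast this
  nlinarith

theorem imaginaryPart_eq_realPart (G : H →L[ℂ] H) :
    (imaginaryPart G : H →L[ℂ] H) = (realPart ((-Complex.I) • G) : H →L[ℂ] H) := by
  rw [imaginaryPart_apply_coe, realPart_apply_coe]
  ext x
  simp [smul_sub, smul_comm Complex.I (2⁻¹ : ℝ)]

theorem singVal_imaginaryPart_le {G : H →L[ℂ] H} {C : ℝ} (h : ∀ k : ℕ, singVal k G ≤ C / (1 + k))
    (k : ℕ) : singVal k (imaginaryPart G : H →L[ℂ] H) ≤ 2 * C / (1 + k) := by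
  rw [imaginaryPart_eq_realPart]
  refine singVal_realPart_le (fun k => ?_) k
  refine (singVal_smul_le k _ G).trans ?_
  simpa using h k

end PositivePart

/-! ### Comparing traces over two finite orthonormal families -/

section Frames

variable {H : Type*} [NormedAddCommGroup H] [InnerProductSpace ℂ H]

theorem starProjection_span_apply {ι : Type*} [Fintype ι] {f : ι → H} (hf : Orthonormal ℂ f)
    (x : H) : (Submodule.span ℂ (Set.range f)).starProjection x = ∑ i, inner ℂ (f i) x • f i := by
  refine (Submodule.eq_starProjection_of_mem_orthogonal ?_ ?_)
  · exact Submodule.sum_mem _ fun i _ => Submodule.smul_mem _ _ (Submodule.subset_span ⟨i, rfl⟩)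
  · rw [span_orthogonal_iff]
    intro i
    rw [inner_sub_right, hf.inner_right_fintype, sub_self]

/-- For the projections `P`, `Q` onto the spans of `f`, `q` this is `Tr(PG) - Tr(QG) = Tr(P(1 - Q)G)
- Tr(QG(1 - P))`, which holds because `Tr(PQG) = Tr(QGP)`. -/
theorem sum_inner_sub_sum_inner {ι κ : Type*} [Fintype ι] [Fintype κ] {f : ι → H} {q : κ → H}
    (hf : Orthonormal ℂ f) (hq : Orthonormal ℂ q) (G : H →L[ℂ] H) :
    ∑ i, inner ℂ (f i) (G (f i)) - ∑ j, inner ℂ (q j) (G (q j)) =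
      ∑ i, inner ℂ (f i) (G (f i) -
        (Submodule.span ℂ (Set.range q)).starProjection (G (f i))) -
      ∑ j, inner ℂ (q j) (G (q j - (Submodule.span ℂ (Set.range f)).starProjection (q j))) := by
  simp only [starProjection_span_apply hf, starProjection_span_apply hq, map_sub, inner_sub_right,
    Finset.sum_sub_distrib, map_sum, map_smul, inner_sum, inner_smul_right]
  rw [Finset.sum_comm (f := fun i j => inner ℂ (q j) (G (f i)) * inner ℂ (f i) (q j))]
  simp only [mul_comm]
  ring

theorem norm_sum_inner_le_card {ι : Type*} [Fintype ι] {f : ι → H} (hf : Orthonormal ℂ f)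
    {g : ι → H} {C : ℝ} (hg : ∀ i, ‖g i‖ ≤ C) :
    ‖∑ i, inner ℂ (f i) (g i)‖ ≤ Fintype.card ι * C := by
  refine (norm_sum_le _ _).trans ?_
  refine (Finset.sum_le_card_nsmul _ _ C fun i _ => ?_).trans (by simp)
  refine (norm_inner_le_norm _ _).trans ?_
  rw [hf.1 i, one_mul]
  exact hg i

/-- By symmetry, the bound on `T(1 - Q)` passes to its adjoint `(1 - Q)T`: for `y = (1 - Q)Tx` one
has `‖y‖² = ⟨Ty, x⟩`. -/
theorem norm_sub_starProjection_le {K : Submodule ℂ H} [K.HasOrthogonalProjection]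
    {T : H →L[ℂ] H} (hT : ∀ x y, inner ℂ (T x) y = inner ℂ x (T y)) {μ : ℝ} (hμ : 0 ≤ μ)
    (hb : ∀ y ∈ Kᗮ, ‖T y‖ ≤ μ * ‖y‖) (x : H) :
    ‖T x - K.starProjection (T x)‖ ≤ μ * ‖x‖ := by
  set y := T x - K.starProjection (T x)
  have hy : y ∈ Kᗮ := Submodule.sub_starProjection_mem_orthogonal _
  rcases eq_or_ne y 0 with h0 | h0
  · rw [h0, norm_zero]
    positivity
  · have h1 : inner ℂ y y = inner ℂ (T y) x := by
      rw [hT]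
      conv_lhs => rw [show inner ℂ y y = inner ℂ y (T x) - inner ℂ y (K.starProjection (T x)) by
        rw [← inner_sub_right]]
      rw [Submodule.inner_left_of_mem_orthogonal (Submodule.starProjection_apply_mem K _) hy,
        sub_zero]
    have h2 : ‖y‖ * ‖y‖ ≤ μ * ‖y‖ * ‖x‖ := by
      calc ‖y‖ * ‖y‖ = ‖inner ℂ y y‖ := by
            rw [inner_self_eq_norm_sq_to_K]; simp [sq]
        _ ≤ ‖T y‖ * ‖x‖ := by rw [h1]; exact norm_inner_le_norm _ _
        _ ≤ _ := by gcongr; exact hb y hy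
    have h3 : 0 < ‖y‖ := norm_pos_iff.mpr h0
    nlinarith

end Frames

/-! ### Traces of products with finite-rank and weak Schatten operators -/

section TraceBounds

variable {H : Type*} [NormedAddCommGroup H] [InnerProductSpace ℂ H] [CompleteSpace H]

/-- The trace is rewritten over an orthonormal basis of the range of `F`, which has at most `r`
elements, so the length of the family `q` does not enter. -/
theorem norm_sum_inner_le_rank {ι : Type*} [Fintype ι] {q : ι → H} (hq : Orthonormal ℂ q)
    {F : H →L[ℂ] H} (W : H →L[ℂ] H) {r : ℕ} (hF : F.toLinearMap.rank ≤ (r : Cardinal)) :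
    ‖∑ j, inner ℂ (q j) (F (W (q j)))‖ ≤ r * (‖F‖ * ‖W‖) := by
  have := finiteDimensional_range_of_rank_le hF
  set K := LinearMap.range F.toLinearMap
  set b := stdOrthonormalBasis ℂ K
  have hu : Orthonormal ℂ fun l => (b l : H) :=
    b.orthonormal.comp_linearIsometry K.subtypeₗᵢ
  have hexp (y : H) (hy : y ∈ K) : y = ∑ l, inner ℂ (b l : H) y • (b l : H) := by
    have := congrArg (Subtype.val) (b.sum_repr' ⟨y, hy⟩)
    simpa using this.symm
  have h1 : ∑ j, inner ℂ (q j) (F (W (q j))) =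
      ∑ l, inner ℂ (ContinuousLinearMap.adjoint (F ∘L W) (b l : H))
        (∑ j, inner ℂ (q j) (b l : H) • q j) := by
    simp only [inner_sum, inner_smul_right, ContinuousLinearMap.adjoint_inner_left,
      ContinuousLinearMap.comp_apply]
    rw [Finset.sum_comm]
    refine Finset.sum_congr rfl fun j _ => ?_
    conv_lhs => rw [hexp (F (W (q j))) ⟨_, rfl⟩]
    simp only [inner_sum, inner_smul_right]
    exact Finset.sum_congr rfl fun l _ => mul_comm _ _
  rw [h1]
  refine (norm_sum_le _ _).trans ?_
  have hle (l) : ‖inner ℂ (ContinuousLinearMap.adjoint (F ∘L W) (b l : H))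
      (∑ j, inner ℂ (q j) (b l : H) • q j)‖ ≤ ‖F‖ * ‖W‖ := by
    refine (norm_inner_le_norm _ _).trans ?_
    rw [← starProjection_span_apply hq]
    have h2 := Submodule.norm_starProjection_apply_le (Submodule.span ℂ (Set.range q)) (b l : H)
    have h3 := (ContinuousLinearMap.adjoint (F ∘L W)).le_opNorm (b l : H)
    rw [hu.1 l] at h2 h3
    rw [LinearIsometryEquiv.norm_map, mul_one] at h3
    calc _ ≤ ‖F ∘L W‖ * 1 := by gcongr
      _ ≤ _ := by rw [mul_one]; exact ContinuousLinearMap.opNorm_comp_le _ _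
  refine (Finset.sum_le_card_nsmul _ _ _ fun l _ => hle l).trans ?_
  rw [nsmul_eq_mul]
  gcongr
  simpa using finrank_range_le_of_rank_le hF

/-- The trace of `Q A W`, `Q` a projection of rank `L`, is `O(L^{1/p} ‖W‖)` for `A` in the weak
Schatten ideal of exponent `p / (p - 1)`. -/
theorem exists_norm_sum_inner_le {p : ℝ} (hp : 1 ≤ p) {A : H →L[ℂ] H}
    (hA : 1 < p → IsWeakSchatten (p / (p - 1)) A) :
    ∃ D : ℝ, 0 ≤ D ∧ ∀ (L : ℕ) (q : Fin L → H), Orthonormal ℂ q → ∀ W : H →L[ℂ] H,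
      ‖∑ j, inner ℂ (q j) (A (W (q j)))‖ ≤ D * (L : ℝ) ^ (1 / p) * ‖W‖ := by
  rcases hp.eq_or_lt with rfl | hp1
  · refine ⟨‖A‖, norm_nonneg _, fun L q hq W => ?_⟩
    refine (norm_sum_inner_le_card hq (C := ‖A‖ * ‖W‖) fun i => ?_).trans ?_
    · refine (A.le_opNorm _).trans ?_
      have := W.le_opNorm (q i)
      rw [hq.1 i, mul_one] at this
      gcongr
    · simp; apply le_of_eq; ring
  obtain ⟨-, C, hC⟩ := hA hp1
  set a : ℝ := 1 / p with ha
  have ha0 : 0 < a := by positivity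
  have ha1 : a < 1 := by rw [ha, div_lt_one (by linarith)]; exact hp1
  have hexp : -(1 / (p / (p - 1))) = a - 1 := by
    rw [ha]; field_simp; ring
  rw [hexp] at hC
  have hC0 : 0 ≤ C := by simpa using (singVal_nonneg 0 A).trans (hC 0)
  set x : ℕ → ℝ := fun i => (2 : ℝ) ^ i with hx
  have hxp (i : ℕ) : 0 < x i := by positivity
  -- Approximants of dyadic rank; `C + 1` instead of `C` makes the inequality strict, so that the
  -- infimum need not be attained.
  have hF (i : ℕ) : ∃ F : H →L[ℂ] H, F.toLinearMap.rank ≤ ((2 ^ i : ℕ) : Cardinal) ∧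
      ‖A - F‖ ≤ (C + 1) * x i ^ (a - 1) := by
    have h1 : singVal (2 ^ i) A < (C + 1) * x i ^ (a - 1) := by
      refine (hC (2 ^ i)).trans_lt ?_
      have h2 : (1 + ((2 ^ i : ℕ) : ℝ)) ^ (a - 1) ≤ x i ^ (a - 1) := by
        refine Real.rpow_le_rpow_of_nonpos (hxp i) ?_ (by linarith)
        simp [hx]
      have h3 : 0 < x i ^ (a - 1) := Real.rpow_pos_of_pos (hxp i) _
      nlinarith
    obtain ⟨F, h2, h3⟩ := exists_rank_le_norm_sub_lt h1
    exact ⟨F, h2, h3.le⟩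
  choose F hFr hFn using hF
  have hxmul (i : ℕ) : x i * x i ^ (a - 1) = x i ^ a := by
    rw [Real.rpow_sub_one (hxp i).ne', mul_div_assoc', mul_div_cancel_left₀ _ (hxp i).ne']
  have h2a : 1 < (2 : ℝ) ^ a := Real.one_lt_rpow (by norm_num) ha0
  have hxsucc (i : ℕ) : x (i + 1) ^ a = x i ^ a * 2 ^ a := by
    rw [← Real.mul_rpow (hxp i).le (by norm_num)]; simp [hx, pow_succ]
  -- The first entry handles `F 0`. The second makes `D + 6(C + 1) ≤ D 2^a`, which is exactly what
  -- the induction over dyadic scales consumes: `F (i+1) - F i` has rank at most `3 · 2^i` and norm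
  -- at most `2 (C + 1) 2^{i(a-1)}`.
  set D : ℝ := max (‖A‖ + (C + 1)) (6 * (C + 1) / (2 ^ a - 1)) with hD
  have hD1 : ‖A‖ + (C + 1) ≤ D := le_max_left _ _
  have hD2 : D + 6 * (C + 1) ≤ D * 2 ^ a := by
    have h1 : 6 * (C + 1) / (2 ^ a - 1) ≤ D := le_max_right _ _
    rw [div_le_iff₀ (by linarith)] at h1
    linarith
  have hD0 : 0 ≤ D := le_trans (by positivity) hD1
  refine ⟨2 ^ a * (D + (C + 1)), by positivity, fun L q hq W => ?_⟩
  have hdy (i : ℕ) : ‖∑ j, inner ℂ (q j) (F i (W (q j)))‖ ≤ D * x i ^ a * ‖W‖ := by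
    induction i with
    | zero =>
      refine (norm_sum_inner_le_rank hq W (hFr 0)).trans ?_
      have h1 : ‖F 0‖ ≤ ‖A‖ + (C + 1) := by
        have h2 := hFn 0
        have h3 : ‖F 0‖ ≤ ‖A‖ + ‖A - F 0‖ := by
          have := norm_sub_le A (A - F 0)
          simpa using this
        simp [hx] at h2
        linarith
      simp [hx]
      gcongr
      linarith
    | succ i ih =>
      have hr : (F (i + 1) - F i).toLinearMap.rank ≤ ((2 ^ (i + 1) + 2 ^ i : ℕ) : Cardinal) := by
        have h1 := rank_add_le_nat (hFr (i + 1)) (rank_smul_le_nat (-1) (hFr i))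
        rwa [neg_one_smul, ← sub_eq_add_neg] at h1
      have hn : ‖F (i + 1) - F i‖ ≤ 2 * ((C + 1) * x i ^ (a - 1)) := by
        have h1 : F (i + 1) - F i = (A - F i) - (A - F (i + 1)) := by abel
        have h2 : x (i + 1) ^ (a - 1) ≤ x i ^ (a - 1) :=
          Real.rpow_le_rpow_of_nonpos (hxp i) (pow_le_pow_right₀ (by norm_num) (Nat.le_succ i))
            (by linarith)
        have h3 : (C + 1) * x (i + 1) ^ (a - 1) ≤ (C + 1) * x i ^ (a - 1) := by gcongr
        rw [h1]
        have := norm_sub_le (A - F i) (A - F (i + 1))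
        linarith [hFn i, hFn (i + 1)]
      have h4 := norm_sum_inner_le_rank hq W hr
      have h5 : ∑ j, inner ℂ (q j) (F (i + 1) (W (q j))) =
          ∑ j, inner ℂ (q j) (F i (W (q j))) +
            ∑ j, inner ℂ (q j) ((F (i + 1) - F i) (W (q j))) := by
        rw [← Finset.sum_add_distrib]
        refine Finset.sum_congr rfl fun j _ => ?_
        rw [← inner_add_right]; simp
      rw [h5, hxsucc]
      have h6 : (((2 ^ (i + 1) + 2 ^ i : ℕ) : ℝ)) = 3 * x i := by
        simp [hx, pow_succ]; ring
      rw [h6] at h4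
      have h7 : 3 * x i * (‖F (i + 1) - F i‖ * ‖W‖) ≤ 6 * (C + 1) * x i ^ a * ‖W‖ := by
        calc 3 * x i * (‖F (i + 1) - F i‖ * ‖W‖)
            ≤ 3 * x i * (2 * ((C + 1) * x i ^ (a - 1)) * ‖W‖) := by
              have := (hxp i).le
              gcongr
          _ = 6 * (C + 1) * (x i * x i ^ (a - 1)) * ‖W‖ := by ring
          _ = _ := by rw [hxmul]
      calc _ ≤ D * x i ^ a * ‖W‖ + 6 * (C + 1) * x i ^ a * ‖W‖ :=
            (norm_add_le _ _).trans (add_le_add ih (h4.trans h7))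
        _ = (D + 6 * (C + 1)) * (x i ^ a * ‖W‖) := by ring
        _ ≤ D * 2 ^ a * (x i ^ a * ‖W‖) := by gcongr
        _ = _ := by ring
  rcases Nat.eq_zero_or_pos L with rfl | hL
  · simp; positivity
  -- The scale is cut at `2^i` between `L` and `2L`; the remainder `A - F i` is then estimated by
  -- `L` times its norm.
  obtain ⟨i, hi1, hi2⟩ : ∃ i : ℕ, L ≤ 2 ^ i ∧ 2 ^ i ≤ 2 * L := by
    refine ⟨Nat.clog 2 L, Nat.le_pow_clog (by norm_num) L, ?_⟩
    rcases Nat.lt_or_ge 1 L with h | h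
    · have h1 := Nat.pow_pred_clog_lt_self (b := 2) (by norm_num) h
      have h2 : 0 < Nat.clog 2 L := Nat.clog_pos (by norm_num) h
      have h3 : 2 ^ Nat.clog 2 L = 2 * 2 ^ (Nat.clog 2 L).pred := by
        rw [← pow_succ']; congr 1; simp; omega
      omega
    · have : L = 1 := by omega
      subst this; simp
  have hi1' : (L : ℝ) ≤ x i := by simp only [hx]; exact_mod_cast hi1
  have hi2' : x i ≤ 2 * L := by simp only [hx]; exact_mod_cast hi2
  have h5 : ∑ j, inner ℂ (q j) (A (W (q j))) =
      ∑ j, inner ℂ (q j) (F i (W (q j))) + ∑ j, inner ℂ (q j) ((A - F i) (W (q j))) := by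
    rw [← Finset.sum_add_distrib]
    refine Finset.sum_congr rfl fun j _ => ?_
    rw [← inner_add_right]; simp
  have h6 : ‖∑ j, inner ℂ (q j) ((A - F i) (W (q j)))‖ ≤ (C + 1) * x i ^ a * ‖W‖ := by
    refine (norm_sum_inner_le_card hq (C := (C + 1) * x i ^ (a - 1) * ‖W‖) fun j => ?_).trans ?_
    · refine ((A - F i).le_opNorm _).trans ?_
      have := W.le_opNorm (q j)
      rw [hq.1 j, mul_one] at this
      have := hFn i
      gcongr
    · rw [← hxmul, Fintype.card_fin]
      have : 0 < x i ^ (a - 1) := Real.rpow_pos_of_pos (hxp i) _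
      calc (L : ℝ) * ((C + 1) * x i ^ (a - 1) * ‖W‖)
          ≤ x i * ((C + 1) * x i ^ (a - 1) * ‖W‖) := by gcongr
        _ = _ := by ring
  have h7 : x i ^ a ≤ 2 ^ a * (L : ℝ) ^ a := by
    rw [← Real.mul_rpow (by norm_num) (by positivity)]
    exact Real.rpow_le_rpow (hxp i).le hi2' ha0.le
  rw [h5]
  calc _ ≤ D * x i ^ a * ‖W‖ + (C + 1) * x i ^ a * ‖W‖ :=
        (norm_add_le _ _).trans (add_le_add (hdy i) h6)
    _ = (D + (C + 1)) * x i ^ a * ‖W‖ := by ring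
    _ ≤ (D + (C + 1)) * (2 ^ a * (L : ℝ) ^ a) * ‖W‖ := by gcongr
    _ = _ := by ring

end TraceBounds

/-! ### Traces of weakly modulated operators -/

section TraceFormula

variable {H : Type*} [NormedAddCommGroup H] [InnerProductSpace ℂ H]

theorem exists_orthonormal_span_eq (K : Submodule ℂ H) [FiniteDimensional ℂ K] :
    ∃ q : Fin (Module.finrank ℂ K) → H, Orthonormal ℂ q ∧
      Submodule.span ℂ (Set.range q) = K := by
  refine ⟨fun i => (stdOrthonormalBasis ℂ K i : H),
    (stdOrthonormalBasis ℂ K).orthonormal.comp_linearIsometry K.subtypeₗᵢ, ?_⟩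
  have h1 := (stdOrthonormalBasis ℂ K).toBasis.span_eq
  have h2 := congrArg (Submodule.map K.subtype) h1
  rw [Submodule.map_span, ← Set.range_comp, Submodule.map_top, Submodule.range_subtype] at h2
  simpa [Function.comp_def] using h2

variable [CompleteSpace H]

/-- The sum of the first `N` singular values of the four positive parts of `G`, combined with
the coefficients `1, -1, i, -i`. -/
noncomputable def partsSingSum (G : H →L[ℂ] H) (N : ℕ) : ℂ :=
  (((∑ k ∈ Finset.range N, singVal k ((realPart G : H →L[ℂ] H)⁺) : ℝ) : ℂ)
      - ((∑ k ∈ Finset.range N, singVal k ((realPart G : H →L[ℂ] H)⁻) : ℝ) : ℂ))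
    + Complex.I * (((∑ k ∈ Finset.range N, singVal k ((imaginaryPart G : H →L[ℂ] H)⁺) : ℝ) : ℂ)
      - ((∑ k ∈ Finset.range N, singVal k ((imaginaryPart G : H →L[ℂ] H)⁻) : ℝ) : ℂ))

/-- `K` is spanned by the first `N` eigenvectors. Allowing any family whose span contains `K` lets
the spectral subspaces of several operators be merged into one. By the comparison identity, the
vectors beyond `K` change the trace by at most `singVal N T` each. -/
theorem exists_spectral_subspace (hinf : ¬ FiniteDimensional ℂ H) {T : H →L[ℂ] H}
    (hc : IsCompactOperator T) (hpos : 0 ≤ T) (N : ℕ) :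
    ∃ K : Submodule ℂ H, FiniteDimensional ℂ K ∧ Module.finrank ℂ K ≤ N ∧
      ∀ (L : ℕ) (q : Fin L → H), Orthonormal ℂ q → K ≤ Submodule.span ℂ (Set.range q) →
        (∀ x, ‖T x - (Submodule.span ℂ (Set.range q)).starProjection (T x)‖ ≤
          singVal N T * ‖x‖) ∧
        ‖∑ j, inner ℂ (q j) (T (q j)) - ((∑ k ∈ Finset.range N, singVal k T : ℝ) : ℂ)‖ ≤
          L * singVal N T := by
  obtain ⟨e, he, hTe, hb⟩ := exists_orthonormal_eigenvectors hinf hc hpos N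
  refine ⟨Submodule.span ℂ (Set.range e), inferInstance, ?_, fun L q hq hK => ⟨?_, ?_⟩⟩
  · exact (finrank_range_le_card (R := ℂ) e).trans (by simp)
  · have hs : T.IsPositive := (ContinuousLinearMap.nonneg_iff_isPositive T).mp hpos
    refine norm_sub_starProjection_le (fun x y => hs.isSelfAdjoint.isSymmetric x y)
      (singVal_nonneg N T) fun y hy => hb y fun i => ?_
    exact hy _ (hK (Submodule.subset_span ⟨i, rfl⟩))
  · have h1 : ∑ i, inner ℂ (e i) (T (e i)) = ((∑ k ∈ Finset.range N, singVal k T : ℝ) : ℂ) := by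
      rw [← Fin.sum_univ_eq_sum_range (fun k => singVal k T)]
      push_cast
      refine Finset.sum_congr rfl fun i _ => ?_
      rw [hTe, inner_smul_right, inner_self_eq_norm_sq_to_K, he.1 i]
      simp
    have h2 := sum_inner_sub_sum_inner he hq T
    have h3 : ∑ i, inner ℂ (e i) (T (e i) -
        (Submodule.span ℂ (Set.range q)).starProjection (T (e i))) = 0 := by
      refine Finset.sum_eq_zero fun i _ => ?_
      rw [Submodule.starProjection_eq_self_iff.mpr, sub_self, inner_zero_right]
      rw [hTe]
      exact Submodule.smul_mem _ _ (hK (Submodule.subset_span ⟨i, rfl⟩))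
    rw [h1, h3, zero_sub] at h2
    rw [← neg_sub, h2, neg_neg]
    refine (norm_sum_inner_le_card hq (C := singVal N T) fun j => ?_).trans (by simp)
    have hy := Submodule.sub_starProjection_mem_orthogonal
      (K := Submodule.span ℂ (Set.range e)) (q j)
    refine (hb _ fun i => hy _ (Submodule.subset_span ⟨i, rfl⟩)).trans ?_
    refine mul_le_of_le_one_right (singVal_nonneg N T) ?_
    rw [← Submodule.starProjection_orthogonal_val]
    exact (Submodule.norm_starProjection_apply_le _ _).trans (hq.1 j).le

theorem singVal_parts_le (hinf : ¬ FiniteDimensional ℂ H) {B : H →L[ℂ] H}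
    (hB : IsSelfAdjoint B) {C : ℝ} (h : ∀ k : ℕ, singVal k B ≤ C / (1 + k)) :
    (IsCompactOperator (B⁺ : H →L[ℂ] H) ∧ ∀ k : ℕ, singVal k (B⁺ : H →L[ℂ] H) ≤ C / (1 + k)) ∧
    (IsCompactOperator (B⁻ : H →L[ℂ] H) ∧ ∀ k : ℕ, singVal k (B⁻ : H →L[ℂ] H) ≤ C / (1 + k)) := by
  have hpos {B : H →L[ℂ] H} (hB : IsSelfAdjoint B) (h : ∀ k : ℕ, singVal k B ≤ C / (1 + k)) :
      IsCompactOperator (B⁺ : H →L[ℂ] H) ∧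
        ∀ k : ℕ, singVal k (B⁺ : H →L[ℂ] H) ≤ C / (1 + k) :=
    ⟨isCompactOperator_posPart hB (isCompactOperator_of_singVal_le h), fun k =>
      (singVal_posPart_le hinf hB (isCompactOperator_of_singVal_le h) k).trans (h k)⟩
  refine ⟨hpos hB h, ?_⟩
  rw [← CFC.posPart_neg]
  refine hpos hB.neg fun k => ?_
  have := singVal_smul_le k (-1) B
  simp only [neg_smul, one_smul, norm_neg, norm_one, one_mul] at this
  exact this.trans (h k)

/-- A single projection serves all four positive parts, whence `L ≤ 4 N`. Each part has singular
values at most `2C / (1 + k)`, so it contributes `2C / (1 + N)` to the first error and `4N · 2C / (1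
+ N) ≤ 8C` to the second. -/
theorem exists_spectral_frame (hinf : ¬ FiniteDimensional ℂ H) {G : H →L[ℂ] H} {C : ℝ}
    (hG : ∀ k : ℕ, singVal k G ≤ C / (1 + k)) (N : ℕ) :
    ∃ (L : ℕ) (q : Fin L → H), L ≤ 4 * N ∧ Orthonormal ℂ q ∧
      (∀ x, ‖G x - (Submodule.span ℂ (Set.range q)).starProjection (G x)‖ ≤
          8 * C / (1 + N) * ‖x‖) ∧
      ‖∑ j, inner ℂ (q j) (G (q j)) - partsSingSum G N‖ ≤ 32 * C := by
  have hC : 0 ≤ C := by simpa using (singVal_nonneg 0 G).trans (hG 0)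
  obtain ⟨⟨c1, s1⟩, c2, s2⟩ := singVal_parts_le hinf (realPart G).2 (singVal_realPart_le hG)
  obtain ⟨⟨c3, s3⟩, c4, s4⟩ := singVal_parts_le hinf (imaginaryPart G).2
    (singVal_imaginaryPart_le hG)
  set B : H →L[ℂ] H := (realPart G).1
  set B' : H →L[ℂ] H := (imaginaryPart G).1
  obtain ⟨K1, f1, d1, h1⟩ := exists_spectral_subspace hinf c1 (CFC.posPart_nonneg B) N
  obtain ⟨K2, f2, d2, h2⟩ := exists_spectral_subspace hinf c2 (CFC.negPart_nonneg B) N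
  obtain ⟨K3, f3, d3, h3⟩ := exists_spectral_subspace hinf c3 (CFC.posPart_nonneg B') N
  obtain ⟨K4, f4, d4, h4⟩ := exists_spectral_subspace hinf c4 (CFC.negPart_nonneg B') N
  obtain ⟨q, hq, hspan⟩ := exists_orthonormal_span_eq ((K1 ⊔ K2) ⊔ (K3 ⊔ K4))
  have hL : Module.finrank ℂ (K1 ⊔ K2 ⊔ (K3 ⊔ K4) : Submodule ℂ H) ≤ 4 * N := by
    have e1 := Submodule.finrank_add_le_finrank_add_finrank K1 K2
    have e2 := Submodule.finrank_add_le_finrank_add_finrank K3 K4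
    have e3 := Submodule.finrank_add_le_finrank_add_finrank (K1 ⊔ K2) (K3 ⊔ K4)
    omega
  generalize Module.finrank ℂ (K1 ⊔ K2 ⊔ (K3 ⊔ K4) : Submodule ℂ H) = L at q hq hspan hL
  obtain ⟨a1, b1⟩ := h1 L q hq (by rw [hspan]; exact le_sup_left.trans le_sup_left)
  obtain ⟨a2, b2⟩ := h2 L q hq (by rw [hspan]; exact le_sup_right.trans le_sup_left)
  obtain ⟨a3, b3⟩ := h3 L q hq (by rw [hspan]; exact le_sup_left.trans le_sup_right)
  obtain ⟨a4, b4⟩ := h4 L q hq (by rw [hspan]; exact le_sup_right.trans le_sup_right)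
  have hGB : G = ((B⁺ : H →L[ℂ] H) - (B⁻ : H →L[ℂ] H)) +
      Complex.I • ((B'⁺ : H →L[ℂ] H) - (B'⁻ : H →L[ℂ] H)) := by
    rw [CFC.posPart_sub_negPart B (realPart G).2, CFC.posPart_sub_negPart B' (imaginaryPart G).2]
    exact (realPart_add_I_smul_imaginaryPart G).symm
  have key (x1 x2 x3 x4 : H) (r : ℝ) (e1 : ‖x1‖ ≤ r) (e2 : ‖x2‖ ≤ r) (e3 : ‖x3‖ ≤ r)
      (e4 : ‖x4‖ ≤ r) : ‖(x1 - x2) + Complex.I • (x3 - x4)‖ ≤ 4 * r := by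
    refine (norm_add_le _ _).trans ?_
    rw [norm_smul, Complex.norm_I, one_mul]
    linarith [norm_sub_le x1 x2, norm_sub_le x3 x4]
  have key' (x1 x2 x3 x4 : ℂ) (r : ℝ) (e1 : ‖x1‖ ≤ r) (e2 : ‖x2‖ ≤ r) (e3 : ‖x3‖ ≤ r)
      (e4 : ‖x4‖ ≤ r) : ‖(x1 - x2) + Complex.I * (x3 - x4)‖ ≤ 4 * r := by
    refine (norm_add_le _ _).trans ?_
    rw [norm_mul, Complex.norm_I, one_mul]
    linarith [norm_sub_le x1 x2, norm_sub_le x3 x4]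
  refine ⟨L, q, hL, hq, fun x => ?_, ?_⟩
  · set Q := (Submodule.span ℂ (Set.range q)).starProjection
    have e : G x - Q (G x) = (((B⁺ : H →L[ℂ] H) x - Q ((B⁺ : H →L[ℂ] H) x)) -
        ((B⁻ : H →L[ℂ] H) x - Q ((B⁻ : H →L[ℂ] H) x))) + Complex.I •
        (((B'⁺ : H →L[ℂ] H) x - Q ((B'⁺ : H →L[ℂ] H) x)) -
        ((B'⁻ : H →L[ℂ] H) x - Q ((B'⁻ : H →L[ℂ] H) x))) := by
      conv_lhs => rw [hGB]
      simp only [add_apply, sub_apply, smul_apply, map_add, map_sub, map_smul, smul_sub]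
      abel
    rw [e]
    refine (key _ _ _ _ (2 * C / (1 + N) * ‖x‖) ((a1 x).trans ?_) ((a2 x).trans ?_)
      ((a3 x).trans ?_) ((a4 x).trans ?_)).trans (le_of_eq (by ring))
    · gcongr; exact s1 N
    · gcongr; exact s2 N
    · gcongr; exact s3 N
    · gcongr; exact s4 N
  · have hLr : (L : ℝ) * (2 * C / (1 + N)) ≤ 8 * C := by
      have h5 : (L : ℝ) ≤ 4 * N := by exact_mod_cast hL
      rw [mul_div_assoc', div_le_iff₀ (by positivity)]
      nlinarith [mul_le_mul_of_nonneg_right h5 hC]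
    have e : ∑ j, inner ℂ (q j) (G (q j)) - partsSingSum G N =
        ((∑ j, inner ℂ (q j) ((B⁺ : H →L[ℂ] H) (q j)) -
          ((∑ k ∈ Finset.range N, singVal k (B⁺ : H →L[ℂ] H) : ℝ) : ℂ)) -
        (∑ j, inner ℂ (q j) ((B⁻ : H →L[ℂ] H) (q j)) -
          ((∑ k ∈ Finset.range N, singVal k (B⁻ : H →L[ℂ] H) : ℝ) : ℂ))) + Complex.I *
        ((∑ j, inner ℂ (q j) ((B'⁺ : H →L[ℂ] H) (q j)) -
          ((∑ k ∈ Finset.range N, singVal k (B'⁺ : H →L[ℂ] H) : ℝ) : ℂ)) -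
        (∑ j, inner ℂ (q j) ((B'⁻ : H →L[ℂ] H) (q j)) -
          ((∑ k ∈ Finset.range N, singVal k (B'⁻ : H →L[ℂ] H) : ℝ) : ℂ))) := by
      have e1 : ∑ j, inner ℂ (q j) (G (q j)) =
          (∑ j, inner ℂ (q j) ((B⁺ : H →L[ℂ] H) (q j)) -
            ∑ j, inner ℂ (q j) ((B⁻ : H →L[ℂ] H) (q j))) + Complex.I *
          (∑ j, inner ℂ (q j) ((B'⁺ : H →L[ℂ] H) (q j)) -
            ∑ j, inner ℂ (q j) ((B'⁻ : H →L[ℂ] H) (q j))) := by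
        conv_lhs => rw [hGB]
        simp only [add_apply, sub_apply, smul_apply, inner_add_right, inner_sub_right,
          inner_smul_right, Finset.sum_add_distrib, Finset.sum_sub_distrib, ← Finset.mul_sum]
      rw [e1, partsSingSum]
      ring
    rw [e]
    refine (key' _ _ _ _ (8 * C) (b1.trans ?_) (b2.trans ?_)
      (b3.trans ?_) (b4.trans ?_)).trans (le_of_eq (by ring))
    · exact (mul_le_mul_of_nonneg_left (s1 N) (by positivity)).trans hLr
    · exact (mul_le_mul_of_nonneg_left (s2 N) (by positivity)).trans hLr
    · exact (mul_le_mul_of_nonneg_left (s3 N) (by positivity)).trans hLr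
    · exact (mul_le_mul_of_nonneg_left (s4 N) (by positivity)).trans hLr

/-- The sum of the diagonal entries of a weakly modulated operator `G = A V` over an orthonormal
family agrees with the sum of its singular values up to explicit errors. -/
theorem exists_norm_diagonal_sub_le (hinf : ¬ FiniteDimensional ℂ H) {G V A : H →L[ℂ] H}
    (hG : IsWeakSchatten 1 G) {p : ℝ} (hp : 1 ≤ p)
    (hA : 1 < p → IsWeakSchatten (p / (p - 1)) A) (hAV : ∀ x, A (V x) = G x) :
    ∃ D : ℝ, 0 ≤ D ∧ ∀ (N : ℕ) {ι : Type} [Fintype ι] (f : ι → H) (ε : ℝ), Orthonormal ℂ f →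
      (∀ x ∈ (Submodule.span ℂ (Set.range f))ᗮ, ‖V x‖ ≤ ε * ‖x‖) → 0 ≤ ε →
      ‖∑ i, inner ℂ (f i) (G (f i)) - partsSingSum G N‖ ≤
        D * (Fintype.card ι / (1 + N) + (N : ℝ) ^ (1 / p) * ε + 1) := by
  obtain ⟨-, C, hC⟩ := hG
  have hC' : ∀ k : ℕ, singVal k G ≤ C / (1 + k) := by
    intro k
    have := hC k
    rwa [div_one, Real.rpow_neg_one, ← div_eq_mul_inv] at this
  have hC0 : 0 ≤ C := by simpa using (singVal_nonneg 0 G).trans (hC' 0)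
  obtain ⟨D, hD, hDb⟩ := exists_norm_sum_inner_le hp hA
  refine ⟨32 * C + D * 4 ^ (1 / p), by positivity, fun N ι _ f ε hf hε hε0 => ?_⟩
  obtain ⟨L, q, hL, hq, h1, h2⟩ := exists_spectral_frame hinf hC' N
  set P := (Submodule.span ℂ (Set.range f)).starProjection
  have hW : ‖V ∘L (1 - P)‖ ≤ ε := by
    refine ContinuousLinearMap.opNorm_le_bound _ hε0 fun x => ?_
    have hx : x - P x ∈ (Submodule.span ℂ (Set.range f))ᗮ :=
      Submodule.sub_starProjection_mem_orthogonal x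
    refine (hε _ hx).trans ?_
    gcongr
    rw [← Submodule.starProjection_orthogonal_val]
    exact Submodule.norm_starProjection_apply_le _ _
  -- Of the two error traces, `h8` bounds the one with `(1 - Q)G` by cardinality times norm. The one
  -- with `G(1 - P) = A V(1 - P)` is bounded in `h4` by the trace estimate for `A`.
  have h3 := sum_inner_sub_sum_inner hf hq G
  have h4 : ‖∑ j, inner ℂ (q j) (G (q j - P (q j)))‖ ≤
      D * 4 ^ (1 / p) * ((N : ℝ) ^ (1 / p) * ε) := by
    have h5 := hDb L q hq (V ∘L (1 - P))
    have h6 : ∑ j, inner ℂ (q j) (A ((V ∘L (1 - P)) (q j))) =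
        ∑ j, inner ℂ (q j) (G (q j - P (q j))) := by
      refine Finset.sum_congr rfl fun j _ => ?_
      rw [← hAV]; rfl
    rw [h6] at h5
    refine h5.trans ?_
    have h7 : (L : ℝ) ^ (1 / p) ≤ 4 ^ (1 / p) * (N : ℝ) ^ (1 / p) := by
      rw [← Real.mul_rpow (by norm_num) (by positivity)]
      refine Real.rpow_le_rpow (by positivity) (by exact_mod_cast hL) (by positivity)
    calc D * (L : ℝ) ^ (1 / p) * ‖V ∘L (1 - P)‖
        ≤ D * (4 ^ (1 / p) * (N : ℝ) ^ (1 / p)) * ε := by gcongr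
      _ = _ := by ring
  have h8 := norm_sum_inner_le_card hf (C := 8 * C / (1 + N)) (g := fun i => G (f i) -
        (Submodule.span ℂ (Set.range q)).starProjection (G (f i))) (fun i => by
      simpa [hf.1 i] using h1 (f i))
  have h9 : ∑ i, inner ℂ (f i) (G (f i)) - partsSingSum G N =
      (∑ i, inner ℂ (f i) (G (f i)) - ∑ j, inner ℂ (q j) (G (q j))) +
      (∑ j, inner ℂ (q j) (G (q j)) - partsSingSum G N) := by ring
  rw [h9, h3]
  refine (norm_add_le _ _).trans (((add_le_add (norm_sub_le _ _) h2)).trans ?_)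
  have e1 : (Fintype.card ι : ℝ) * (8 * C / (1 + N)) ≤ 32 * C * (Fintype.card ι / (1 + N)) := by
    have : 0 ≤ C * ((Fintype.card ι : ℝ) / (1 + N)) := by positivity
    calc (Fintype.card ι : ℝ) * (8 * C / (1 + N)) = 8 * (C * (Fintype.card ι / (1 + N))) := by ring
      _ ≤ 32 * (C * (Fintype.card ι / (1 + N))) := by linarith
      _ = _ := by ring
  have e2 : 0 ≤ D * 4 ^ (1 / p) * ((Fintype.card ι : ℝ) / (1 + N)) := by positivity
  have e3 : 0 ≤ 32 * C * ((N : ℝ) ^ (1 / p) * ε) := by positivity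
  have e4 : 0 ≤ D * 4 ^ (1 / p) := by positivity
  linarith

end TraceFormula

/-! ### Passing to extended limits -/

section ExtendedLimits

/-- At `N = 0, 1` the logarithm is `0` and the quotient takes the value `0`; from `N = 2` on, `log N
≥ log 2`. -/
theorem norm_div_log_le {E : ℝ} (hE : 0 ≤ E) {d : ℂ} {N : ℕ} (hd : 1 ≤ N → ‖d‖ ≤ E) :
    ‖d / (Real.log N : ℂ)‖ ≤ E / Real.log 2 := by
  have h2 : 0 < Real.log 2 := Real.log_pos (by norm_num)
  rcases Nat.lt_or_ge N 2 with h | h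
  · have : Real.log N = 0 := by interval_cases N <;> simp
    rw [this]; simp; positivity
  · have h3 : Real.log 2 ≤ Real.log N := Real.log_le_log (by norm_num) (by exact_mod_cast h)
    rw [norm_div, Complex.norm_real, Real.norm_of_nonneg (h2.le.trans h3)]
    exact div_le_div₀ hE (hd (by omega)) h2 h3

theorem sum_div_one_add_le_log {C : ℝ} (hC : 0 ≤ C) {a : ℕ → ℝ} (ha : ∀ k, a k ≤ C / (1 + k))
    {N : ℕ} (hN : 2 ≤ N) :
    ∑ k ∈ Finset.range (N + 1), a k ≤ C * (1 / Real.log 2 + 2) * Real.log N := by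
  have h2 : 0 < Real.log 2 := Real.log_pos (by norm_num)
  have hN' : (2 : ℝ) ≤ N := by exact_mod_cast hN
  have h3 : Real.log 2 ≤ Real.log N := Real.log_le_log (by norm_num) hN'
  have h1 : ∑ k ∈ Finset.range (N + 1), a k ≤ C * (harmonic (N + 1) : ℝ) := by
    rw [harmonic]
    push_cast
    rw [Finset.mul_sum]
    refine Finset.sum_le_sum fun k _ => (ha k).trans (le_of_eq ?_)
    rw [div_eq_mul_inv, add_comm]
  have h4 := harmonic_le_one_add_log (N + 1)
  have h5 : Real.log ((N + 1 : ℕ) : ℝ) ≤ 2 * Real.log N := by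
    have h6 : Real.log ((N + 1 : ℕ) : ℝ) ≤ Real.log ((N : ℝ) ^ 2) := by
      refine Real.log_le_log (by positivity) ?_
      push_cast
      nlinarith
    simpa using h6
  have h6 : 1 ≤ 1 / Real.log 2 * Real.log N := by
    rw [one_div, ← div_eq_inv_mul, le_div_iff₀ h2]; linarith
  calc _ ≤ C * (harmonic (N + 1) : ℝ) := h1
    _ ≤ C * ((1 / Real.log 2 + 2) * Real.log N) := by gcongr; linarith
    _ = _ := by ring

variable {H : Type*} [NormedAddCommGroup H] [InnerProductSpace ℂ H]

theorem memlp_sum_singVal_div_log {T : H →L[ℂ] H} {C : ℝ}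
    (h : ∀ k : ℕ, singVal k T ≤ C / (1 + k)) :
    Memℓp (fun N : ℕ => (((∑ k ∈ Finset.range (N + 1), singVal k T) / Real.log N : ℝ) : ℂ)) ∞ := by
  have hC : 0 ≤ C := by simpa using (singVal_nonneg 0 T).trans (h 0)
  have h2 : 0 < Real.log 2 := Real.log_pos (by norm_num)
  refine memℓp_infty ⟨C * (1 / Real.log 2 + 2), ?_⟩
  rintro _ ⟨N, rfl⟩
  simp only [Complex.norm_real, Real.norm_eq_abs, abs_div]
  rcases Nat.lt_or_ge N 2 with hN | hN
  · have : Real.log N = 0 := by interval_cases N <;> simp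
    rw [this]; simp; positivity
  · have hl : 0 < Real.log N := Real.log_pos (by exact_mod_cast hN)
    rw [abs_of_pos hl, div_le_iff₀ hl, abs_of_nonneg (Finset.sum_nonneg fun k _ => singVal_nonneg k T)]
    exact sum_div_one_add_le_log hC h hN

variable [CompleteSpace H]

/-- A bounded error divided by `log N` tends to `0`, so `ω` annihilates it. The index `N + 1`
matches the sum over `0 ≤ k ≤ N` in the Dixmier trace. -/
theorem dixmierTrace_eq_of_norm_sub_le (hinf : ¬ FiniteDimensional ℂ H) {G : H →L[ℂ] H}
    (hG : IsWeakSchatten 1 G) {ω : EllInfty →L[ℂ] ℂ} (hω : IsExtendedLimit ω) {t : ℕ → ℂ} {E : ℝ}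
    (ht : ∀ N : ℕ, 1 ≤ N → ‖t N - partsSingSum G (N + 1)‖ ≤ E) :
    ∃ h : Memℓp (fun N : ℕ => t N / (Real.log N : ℂ)) ∞, dixmierTrace ω G = ω ⟨_, h⟩ := by
  obtain ⟨-, C, hC⟩ := hG
  have hC' : ∀ k : ℕ, singVal k G ≤ C / (1 + k) := by
    intro k
    have := hC k
    rwa [div_one, Real.rpow_neg_one, ← div_eq_mul_inv] at this
  have hE : 0 ≤ E := (norm_nonneg _).trans (ht 1 le_rfl)
  obtain ⟨⟨-, s1⟩, -, s2⟩ := singVal_parts_le hinf (realPart G).2 (singVal_realPart_le hC')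
  obtain ⟨⟨-, s3⟩, -, s4⟩ := singVal_parts_le hinf (imaginaryPart G).2
    (singVal_imaginaryPart_le hC')
  have m1 := memlp_sum_singVal_div_log s1
  have m2 := memlp_sum_singVal_div_log s2
  have m3 := memlp_sum_singVal_div_log s3
  have m4 := memlp_sum_singVal_div_log s4
  have hd : Memℓp (fun N : ℕ => (t N - partsSingSum G (N + 1)) / (Real.log N : ℂ)) ∞ := by
    refine memℓp_infty ⟨E / Real.log 2, ?_⟩
    rintro _ ⟨N, rfl⟩
    exact norm_div_log_le hE (ht N)
  have hlim : Tendsto (fun N : ℕ => (t N - partsSingSum G (N + 1)) / (Real.log N : ℂ)) atTop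
      (𝓝 0) := by
    have h1 : Tendsto (fun N : ℕ => E / Real.log N) atTop (𝓝 0) :=
      tendsto_const_nhds.div_atTop (Real.tendsto_log_atTop.comp tendsto_natCast_atTop_atTop)
    refine squeeze_zero_norm' ?_ h1
    filter_upwards [eventually_ge_atTop 1] with N hN
    rw [norm_div, Complex.norm_real, Real.norm_of_nonneg (Real.log_natCast_nonneg N)]
    gcongr
    exact ht N hN
  set b1 : EllInfty := ⟨_, m1⟩
  set b2 : EllInfty := ⟨_, m2⟩
  set b3 : EllInfty := ⟨_, m3⟩
  set b4 : EllInfty := ⟨_, m4⟩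
  set d : EllInfty := ⟨_, hd⟩
  have heq : (fun N : ℕ => t N / (Real.log N : ℂ)) =
      ⇑(((b1 - b2) + Complex.I • (b3 - b4)) + d) := by
    funext N
    simp only [lp.coeFn_add, lp.coeFn_sub, lp.coeFn_smul, Pi.add_apply, Pi.sub_apply,
      Pi.smul_apply, smul_eq_mul, b1, b2, b3, b4, d, partsSingSum]
    push_cast
    ring
  refine ⟨heq ▸ lp.memℓp _, ?_⟩
  have hsub : (⟨_, heq ▸ lp.memℓp _⟩ : EllInfty) = ((b1 - b2) + Complex.I • (b3 - b4)) + d :=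
    Subtype.ext heq
  rw [hsub, map_add, hω.singular d hlim, add_zero, map_add, map_smul, map_sub, map_sub]
  simp only [dixmierTrace, dixmierTracePos, omegaLim]
  rw [dif_pos m1, dif_pos m2, dif_pos m3, dif_pos m4, smul_eq_mul]

end ExtendedLimits

/-! ### Gaussian integrals of monomials -/

section Gaussian

/-- Polar coordinates: homogeneity separates the variables, and the radial integral is a Gamma
value. Spherical integrals of monomials are thereby read off from Gaussian ones. -/
theorem integral_homogeneous_mul_exp_neg_sq {E : Type*} [NormedAddCommGroup E] [NormedSpace ℝ E]
    [MeasurableSpace E] [BorelSpace E] [FiniteDimensional ℝ E] [Nontrivial E] (μ : Measure E)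
    [μ.IsAddHaarMeasure] (g : E → ℂ) (k : ℕ)
    (hg : ∀ (r : ℝ) (x : E), 0 < r → g (r • x) = (r : ℂ) ^ k * g x) :
    ∫ x, g x * (Real.exp (-‖x‖ ^ 2) : ℂ) ∂μ = (∫ s, g s ∂μ.toSphere) *
      ((Real.Gamma (((Module.finrank ℝ E : ℝ) + k) / 2) / 2 : ℝ) : ℂ) := by
  have hdim : 1 ≤ Module.finrank ℝ E := Module.finrank_pos
  have hrad : ∫ r : Set.Ioi (0 : ℝ), ((r : ℝ) : ℂ) ^ k * (Real.exp (-(r : ℝ) ^ 2) : ℂ)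
      ∂(Measure.volumeIoiPow (Module.finrank ℝ E - 1)) =
      ((Real.Gamma (((Module.finrank ℝ E : ℝ) + k) / 2) / 2 : ℝ) : ℂ) := by
    have h1 : ∫ r : Set.Ioi (0 : ℝ), ((r : ℝ) : ℂ) ^ k * (Real.exp (-(r : ℝ) ^ 2) : ℂ)
        ∂(Measure.volumeIoiPow (Module.finrank ℝ E - 1)) =
        ((∫ r : Set.Ioi (0 : ℝ), (r : ℝ) ^ k * Real.exp (-(r : ℝ) ^ 2)
        ∂(Measure.volumeIoiPow (Module.finrank ℝ E - 1)) : ℝ) : ℂ) := by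
      rw [← integral_complex_ofReal]
      push_cast
      rfl
    rw [h1]
    congr 1
    simp only [Measure.volumeIoiPow, ENNReal.ofReal]
    rw [integral_withDensity_eq_integral_smul
      (measurable_subtype_coe.pow_const _).real_toNNReal]
    rw [integral_subtype_comap measurableSet_Ioi
      fun a : ℝ => Real.toNNReal (a ^ (Module.finrank ℝ E - 1)) • (a ^ k * Real.exp (-a ^ 2))]
    have h2 := integral_rpow_mul_exp_neg_rpow (p := 2) (q := (Module.finrank ℝ E : ℝ) - 1 + k)
      (by norm_num) (by
        have : (1 : ℝ) ≤ Module.finrank ℝ E := by exact_mod_cast hdim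
        have : (0 : ℝ) ≤ k := by positivity
        linarith)
    have h3 : ((Module.finrank ℝ E : ℝ) - 1 + k + 1) / 2 = ((Module.finrank ℝ E : ℝ) + k) / 2 := by
      ring
    rw [h3] at h2
    rw [div_eq_mul_inv, mul_comm, ← one_div, ← h2]
    refine setIntegral_congr_fun measurableSet_Ioi fun r (hr : 0 < r) => ?_
    simp only [NNReal.smul_def]
    rw [Real.coe_toNNReal _ (by positivity), smul_eq_mul, ← mul_assoc, ← pow_add]
    have h5 : r ^ ((Module.finrank ℝ E : ℝ) - 1 + k) = r ^ (Module.finrank ℝ E - 1 + k) := by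
      rw [← Real.rpow_natCast]; congr 1; push_cast [Nat.cast_sub hdim]; ring
    rw [h5, Real.rpow_two]
  rw [← hrad, ← integral_prod_mul (μ := μ.toSphere)
    (f := fun s : Metric.sphere (0 : E) 1 => g s)
    (g := fun r : Set.Ioi (0 : ℝ) => ((r : ℝ) : ℂ) ^ k * (Real.exp (-(r : ℝ) ^ 2) : ℂ)),
    ← μ.measurePreserving_homeomorphUnitSphereProd.integral_comp
      (Homeomorph.measurableEmbedding _)]
  have hL : ∫ x, g x * (Real.exp (-‖x‖ ^ 2) : ℂ) ∂μ =
      ∫ x : ({0}ᶜ : Set E), g x * (Real.exp (-‖(x : E)‖ ^ 2) : ℂ) ∂(μ.comap (↑)) := by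
    rw [integral_subtype_comap (measurableSet_singleton (0 : E)).compl
      fun x => g x * (Real.exp (-‖x‖ ^ 2) : ℂ), restrict_compl_singleton]
  rw [hL]
  refine integral_congr_ae (Eventually.of_forall fun x => ?_)
  have hx : 0 < ‖(x : E)‖ := norm_pos_iff.mpr x.2
  simp only [homeomorphUnitSphereProd_apply_fst_coe, homeomorphUnitSphereProd_apply_snd_coe]
  have h4 := hg ‖(x : E)‖ (‖(x : E)‖⁻¹ • (x : E)) hx
  rw [smul_inv_smul₀ hx.ne'] at h4
  rw [h4]
  push_cast
  ring

theorem integral_pow_mul_conj_pow_mul_exp_neg_sq (a b : ℕ) :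
    ∫ z : ℂ, z ^ a * star z ^ b * (Real.exp (-‖z‖ ^ 2) : ℂ) =
      if a = b then (Real.pi : ℂ) * (a.factorial : ℂ) else 0 := by
  split_ifs with h
  · subst h
    have h1 := Complex.integral_rpow_mul_exp_neg_mul_rpow (p := 2) (q := 2 * a) (b := 1)
      (by norm_num) (by have : (0 : ℝ) ≤ a := by positivity
                        linarith) one_pos
    have h2 : ∫ z : ℂ, z ^ a * star z ^ a * (Real.exp (-‖z‖ ^ 2) : ℂ) =
        ((∫ z : ℂ, ‖z‖ ^ (2 * a : ℝ) * Real.exp (-1 * ‖z‖ ^ (2 : ℝ)) : ℝ) : ℂ) := by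
      rw [← integral_complex_ofReal]
      refine integral_congr_ae (Eventually.of_forall fun z => ?_)
      have e1 : ‖z‖ ^ (2 * a : ℝ) = (‖z‖ ^ 2) ^ a := by
        rw [← pow_mul, ← Real.rpow_natCast]; push_cast; rfl
      have e2 : z * star z = ((‖z‖ ^ 2 : ℝ) : ℂ) := by
        rw [← starRingEnd_apply, Complex.mul_conj, Complex.normSq_eq_norm_sq]
      simp only
      rw [e1, ← mul_pow, e2]
      push_cast
      norm_num
    rw [h2, h1]
    have e3 : ((2 * a : ℝ) + 2) / 2 = a + 1 := by ring
    rw [e3, Real.Gamma_nat_eq_factorial]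
    push_cast
    simp
  -- The rotation is chosen with `ζ^(a - b) = -1`, so rotation invariance equates the integral with
  -- its negative.
  · set ζ : Circle := Circle.exp (Real.pi / ((a : ℝ) - b)) with hζ
    have hab : (a : ℂ) - b ≠ 0 := sub_ne_zero.mpr (by exact_mod_cast h)
    have hζ1 : (ζ : ℂ) ^ a * star (ζ : ℂ) ^ b = -1 := by
      have e1 : star (ζ : ℂ) = (ζ : ℂ)⁻¹ := by
        rw [← starRingEnd_apply, ← Circle.coe_inv_eq_conj, Circle.coe_inv]
      rw [e1, hζ, Circle.coe_exp, ← Complex.exp_neg, ← Complex.exp_nat_mul, ← Complex.exp_nat_mul,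
        ← Complex.exp_add, ← Complex.exp_pi_mul_I]
      congr 1
      push_cast
      field_simp
      ring
    have h1 := (rotation ζ).measurePreserving.integral_comp
      (rotation ζ).toHomeomorph.measurableEmbedding
      (fun z : ℂ => z ^ a * star z ^ b * (Real.exp (-‖z‖ ^ 2) : ℂ))
    have h2 : ∀ z : ℂ, (rotation ζ z) ^ a * star (rotation ζ z) ^ b *
        (Real.exp (-‖rotation ζ z‖ ^ 2) : ℂ) =
        (-1) * (z ^ a * star z ^ b * (Real.exp (-‖z‖ ^ 2) : ℂ)) := by
      intro z
      rw [LinearIsometryEquiv.norm_map, rotation_apply, star_mul', mul_pow, mul_pow, ← hζ1]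
      ring
    simp only [h2] at h1
    rw [integral_const_mul] at h1
    have h3 : (2 : ℂ) * ∫ z : ℂ, z ^ a * star z ^ b * (Real.exp (-‖z‖ ^ 2) : ℂ) = 0 := by
      linear_combination -h1
    exact (mul_eq_zero.mp h3).resolve_left (by norm_num)

/-- The constant `c` compares the Euclidean volume with the product measure, by uniqueness of Haar
measure. Its value is irrelevant because the sphere is normalized afterwards. -/
theorem exists_integral_monomial_gaussian (m : ℕ) :
    ∃ c : ℝ, ∀ α β : Fin m → ℕ,
      ∫ z : CSpace m, (∏ i, z i ^ α i * star (z i) ^ β i) * (Real.exp (-‖z‖ ^ 2) : ℂ) =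
        (c : ℂ) * if α = β then (Real.pi : ℂ) ^ m * ∏ i, ((α i).factorial : ℂ) else 0 := by
  set e : (Fin m → ℂ) ≃L[ℝ] CSpace m :=
    (PiLp.continuousLinearEquiv 2 ℝ (fun _ : Fin m => ℂ)).symm with he
  set ν : Measure (CSpace m) := Measure.map e (volume : Measure (Fin m → ℂ))
  have hν : ν.IsAddHaarMeasure := ContinuousLinearEquiv.isAddHaarMeasure_map e volume
  obtain ⟨c, hvol⟩ : ∃ c : NNReal, (volume : Measure (CSpace m)) = c • ν :=
    ⟨_, Measure.isAddLeftInvariant_eq_smul _ _⟩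
  refine ⟨c, fun α β => ?_⟩
  rw [hvol, integral_smul_nnreal_measure, NNReal.smul_def, Complex.real_smul]
  congr 1
  have h1 : ∫ z : CSpace m, (∏ i, z i ^ α i * star (z i) ^ β i) * (Real.exp (-‖z‖ ^ 2) : ℂ) ∂ν =
      ∫ x : Fin m → ℂ, ∏ i, (x i ^ α i * star (x i) ^ β i * (Real.exp (-‖x i‖ ^ 2) : ℂ)) := by
    rw [show ν = Measure.map e.toHomeomorph volume from rfl,
      e.toHomeomorph.measurableEmbedding.integral_map]
    refine integral_congr_ae (Eventually.of_forall fun x => ?_)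
    have e1 : ‖e x‖ ^ 2 = ∑ i, ‖x i‖ ^ 2 := EuclideanSpace.norm_sq_eq _
    have e2 : ∀ i, (e x) i = x i := fun i => rfl
    simp only [ContinuousLinearEquiv.coe_toHomeomorph, e2]
    simp only [e1, Finset.prod_mul_distrib, ← Finset.sum_neg_distrib, Real.exp_sum]
    push_cast
    rfl
  rw [h1, integral_fintype_prod_volume_eq_prod
    (f := fun i (x : ℂ) => x ^ α i * star x ^ β i * (Real.exp (-‖x‖ ^ 2) : ℂ))]
  simp only [integral_pow_mul_conj_pow_mul_exp_neg_sq]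
  split_ifs with h
  · subst h
    simp [Finset.prod_mul_distrib]
  · obtain ⟨i, hi⟩ := Function.ne_iff.mp h
    exact Finset.prod_eq_zero (Finset.mem_univ i) (by simp [hi])

end Gaussian

/-! ### Orthogonality of monomials on the sphere -/

section SphereIntegrals

variable {m : ℕ}

theorem nontrivial_cSpace (hm : 1 ≤ m) : Nontrivial (CSpace m) := by
  have : NeZero m := ⟨by omega⟩
  exact Module.nontrivial_of_finrank_pos (R := ℂ) (by simp; omega)

theorem integral_sphereVol_monomial (hm : 1 ≤ m) (α β : Fin m → ℕ) :
    ∫ z : CSphere m, ∏ i, (z : CSpace m) i ^ α i * star ((z : CSpace m) i) ^ β i ∂sphereVol m =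
      if α = β then (((m - 1).factorial * ∏ i, (α i).factorial : ℕ) : ℂ) /
        ((m - 1 + ∑ i, α i).factorial : ℂ) else 0 := by
  have := nontrivial_cSpace hm
  set σ := (volume : Measure (CSpace m)).toSphere
  have hσ : σ ≠ 0 := Measure.toSphere_ne_zero _
  have hu : σ.real Set.univ ≠ 0 := by
    rw [Measure.real, ENNReal.toReal_ne_zero]
    exact ⟨by simpa using hσ, measure_ne_top _ _⟩
  obtain ⟨c, hc⟩ := exists_integral_monomial_gaussian m
  have hdim : (Module.finrank ℝ (CSpace m) : ℝ) = 2 * m := by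
    rw [finrank_real_of_complex]; simp
  have key (α β : Fin m → ℕ) := (hc α β).symm.trans <|
    integral_homogeneous_mul_exp_neg_sq (volume : Measure (CSpace m))
      (fun z => ∏ i, z i ^ α i * star (z i) ^ β i) (∑ i, (α i + β i)) (fun r x hr => by
        rw [← Finset.prod_pow_eq_pow_sum, ← Finset.prod_mul_distrib]
        refine Finset.prod_congr rfl fun i _ => ?_
        simp only [PiLp.smul_apply, Complex.real_smul, star_mul', Complex.star_def,
          Complex.conj_ofReal]
        ring)
  have hint : ∫ z : CSphere m, ∏ i, (z : CSpace m) i ^ α i * star ((z : CSpace m) i) ^ β i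
      ∂sphereVol m = ((σ.real Set.univ : ℂ))⁻¹ *
      ∫ z : CSphere m, ∏ i, (z : CSpace m) i ^ α i * star ((z : CSpace m) i) ^ β i ∂σ := by
    rw [sphereVol, integral_smul_measure, ENNReal.toReal_inv, Complex.real_smul]
    push_cast
    rfl
  have hΓ (n : ℕ) : Real.Gamma ((m : ℝ) + n) = ((m - 1 + n).factorial : ℝ) := by
    rw [← Real.Gamma_nat_eq_factorial]
    congr 1
    push_cast [Nat.cast_sub hm]; ring
  -- The zero exponents express the total surface mass through the same `c`, which then cancels from
  -- the normalized integral.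
  have h0 := key 0 0
  have hα := key α β
  have e1 (n : ℕ) : ((2 * m : ℝ) + (2 * n : ℕ)) / 2 = m + n := by push_cast; ring
  rw [hint]
  split_ifs with h
  · subst h
    have e2 : ∑ i, (α i + α i) = 2 * ∑ i, α i := by rw [Finset.mul_sum]; simp [two_mul]
    rw [hdim, e2, e1, hΓ] at hα
    have e3 : ∑ i : Fin m, ((0 : Fin m → ℕ) i + (0 : Fin m → ℕ) i) = 2 * 0 := by simp
    rw [hdim, e3, e1, hΓ] at h0
    simp only [if_true, Pi.zero_apply, pow_zero, mul_one, Finset.prod_const_one, integral_const,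
      Nat.factorial_zero, Nat.cast_one, add_zero, Complex.real_smul] at h0
    rw [if_pos rfl] at hα
    set I := ∫ z : CSphere m, ∏ i, (z : CSpace m) i ^ α i * star ((z : CSpace m) i) ^ α i ∂σ
    have hf : (((m - 1 + ∑ i, α i).factorial : ℝ) : ℂ) ≠ 0 := by
      exact_mod_cast Nat.factorial_ne_zero _
    have hu' : (σ.real Set.univ : ℂ) ≠ 0 := by exact_mod_cast hu
    push_cast at hα h0 hf ⊢
    rw [eq_div_iff hf]
    field_simp
    linear_combination (-2 : ℂ) * hα + (2 : ℂ) * (∏ i, ((α i).factorial : ℂ)) * h0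
  · rw [if_neg h, mul_zero] at hα
    have hg : ((Real.Gamma (((Module.finrank ℝ (CSpace m) : ℝ) + (∑ i, (α i + β i) : ℕ)) / 2) / 2
        : ℝ) : ℂ) ≠ 0 := by
      have : 0 < Real.Gamma (((Module.finrank ℝ (CSpace m) : ℝ) + (∑ i, (α i + β i) : ℕ)) / 2) := by
        refine Real.Gamma_pos_of_pos ?_
        rw [hdim]
        have : (1 : ℝ) ≤ m := by exact_mod_cast hm
        positivity
      exact_mod_cast (half_pos this).ne'
    rw [(mul_eq_zero.mp hα.symm).resolve_right hg, mul_zero]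

end SphereIntegrals

/-! ### Monomial Hilbert basis of the Hardy space -/

section HardyBasis

variable {m : ℕ}

theorem polyRestrict_apply (p : MvPolynomial (Fin m) ℂ) (z : CSphere m) :
    polyRestrict m p z = polyFun p (z : CSpace m) := by
  induction p using MvPolynomial.induction_on with
  | C a => simp [polyRestrict, polyFun]
  | add p q hp hq => simp [polyFun] at hp hq ⊢; rw [hp, hq]
  | mul_X p i hp => simp [polyFun] at hp ⊢; rw [hp]; simp [polyRestrict, sphereCoord]

/-- The element of the Hardy space given by a holomorphic polynomial. -/
noncomputable def hardyPoly (m : ℕ) : MvPolynomial (Fin m) ℂ →ₗ[ℂ] hardySpace m :=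
  LinearMap.codRestrict (hardySpace m)
    ((ContinuousMap.toLp 2 (sphereVol m) ℂ :
      C(CSphere m, ℂ) →L[ℂ] Lp ℂ 2 (sphereVol m)).toLinearMap ∘ₗ (polyRestrict m).toLinearMap)
    fun p => Submodule.le_topologicalClosure _ ⟨p, rfl⟩

theorem coe_hardyPoly (p : MvPolynomial (Fin m) ℂ) :
    (hardyPoly m p : Lp ℂ 2 (sphereVol m)) =
      ContinuousMap.toLp 2 (sphereVol m) ℂ (polyRestrict m p) := rfl

theorem coeFn_hardyPoly (p : MvPolynomial (Fin m) ℂ) :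
    ⇑(hardyPoly m p : Lp ℂ 2 (sphereVol m)) =ᵐ[sphereVol m]
      fun z => polyFun p (z : CSpace m) := by
  rw [coe_hardyPoly]
  filter_upwards [ContinuousMap.coeFn_toLp (p := 2) (𝕜 := ℂ) (sphereVol m) (polyRestrict m p)]
    with z hz
  rw [hz, polyRestrict_apply]

theorem denseRange_hardyPoly : DenseRange (hardyPoly m) := by
  intro x
  rw [Metric.mem_closure_iff]
  intro ε hε
  have hx : (x : Lp ℂ 2 (sphereVol m)) ∈ closure ((LinearMap.range
      ((ContinuousMap.toLp 2 (sphereVol m) ℂ :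
      C(CSphere m, ℂ) →L[ℂ] Lp ℂ 2 (sphereVol m)).toLinearMap ∘ₗ
      (polyRestrict m).toLinearMap) : Submodule ℂ (Lp ℂ 2 (sphereVol m))) :
        Set (Lp ℂ 2 (sphereVol m))) := x.2
  obtain ⟨_, ⟨p, rfl⟩, hp⟩ := Metric.mem_closure_iff.mp hx ε hε
  exact ⟨_, ⟨p, rfl⟩, hp⟩

/-- The monomial `z ^ α`. -/
noncomputable def multiMonomial (α : Fin m → ℕ) : MvPolynomial (Fin m) ℂ :=
  MvPolynomial.monomial (Finsupp.equivFunOnFinite.symm α) 1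

theorem polyFun_multiMonomial (α : Fin m → ℕ) (z : CSpace m) :
    polyFun (multiMonomial α) z = ∏ i, z i ^ α i := by
  simp [polyFun, multiMonomial, MvPolynomial.eval_monomial, Finsupp.prod_fintype]

/-- The factor that normalizes the monomial `z ^ α` in the Hardy space. -/
noncomputable def monomialNormFactor (α : Fin m → ℕ) : ℝ :=
  √(((m - 1 + ∑ i, α i).factorial : ℝ) / (((m - 1).factorial * ∏ i, (α i).factorial : ℕ) : ℝ))

theorem monomialNormFactor_sq (α : Fin m → ℕ) : monomialNormFactor α ^ 2 =
    ((m - 1 + ∑ i, α i).factorial : ℝ) / (((m - 1).factorial * ∏ i, (α i).factorial : ℕ) : ℝ) :=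
  Real.sq_sqrt (by positivity)

theorem monomialNormFactor_pos (α : Fin m → ℕ) : 0 < monomialNormFactor α := by
  refine Real.sqrt_pos.mpr (div_pos (by positivity) ?_)
  exact_mod_cast Nat.mul_pos (Nat.factorial_pos _)
    (Finset.prod_pos fun i _ => Nat.factorial_pos _)

/-- The normalized monomials in the Hardy space. -/
noncomputable def hardyMono (α : Fin m → ℕ) : hardySpace m :=
  (monomialNormFactor α : ℂ) • hardyPoly m (multiMonomial α)

theorem coeFn_hardyMono (α : Fin m → ℕ) :
    ⇑(hardyMono α : Lp ℂ 2 (sphereVol m)) =ᵐ[sphereVol m]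
      fun z => (monomialNormFactor α : ℂ) * ∏ i, (z : CSpace m) i ^ α i := by
  have h := Lp.coeFn_smul (monomialNormFactor α : ℂ)
    (hardyPoly m (multiMonomial α) : Lp ℂ 2 (sphereVol m))
  filter_upwards [h, coeFn_hardyPoly (multiMonomial α)] with z h1 h2
  rw [polyFun_multiMonomial] at h2
  rw [← h2]
  exact h1

theorem inner_hardyMono (hm : 1 ≤ m) (α β : Fin m → ℕ) :
    inner ℂ (hardyMono α) (hardyMono β) = if α = β then (1 : ℂ) else 0 := by
  rw [hardyMono, hardyMono, Submodule.coe_inner, Submodule.coe_smul, Submodule.coe_smul,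
    inner_smul_left, inner_smul_right, coe_hardyPoly, coe_hardyPoly, ContinuousMap.inner_toLp]
  have h1 : ∫ z : CSphere m, polyRestrict m (multiMonomial β) z *
      (starRingEnd ℂ) (polyRestrict m (multiMonomial α) z) ∂sphereVol m =
      ∫ z : CSphere m, ∏ i, (z : CSpace m) i ^ β i * star ((z : CSpace m) i) ^ α i
        ∂sphereVol m := by
    refine integral_congr_ae (Eventually.of_forall fun z => ?_)
    simp only [polyRestrict_apply, polyFun_multiMonomial, map_prod, map_pow,
      Finset.prod_mul_distrib]
    rfl
  rw [h1, integral_sphereVol_monomial hm]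
  by_cases h : α = β
  · subst h
    simp only [if_true, Complex.conj_ofReal]
    have h2 := monomialNormFactor_sq α
    have h3 : (((m - 1 + ∑ i, α i).factorial : ℂ)) ≠ 0 := by
      exact_mod_cast Nat.factorial_ne_zero _
    have h4 : ((((m - 1).factorial * ∏ i, (α i).factorial : ℕ) : ℂ)) ≠ 0 := by
      exact_mod_cast (Nat.mul_pos (Nat.factorial_pos _)
        (Finset.prod_pos fun i _ => Nat.factorial_pos _)).ne'
    have h5 : (monomialNormFactor α : ℂ) * (monomialNormFactor α : ℂ) =
        ((m - 1 + ∑ i, α i).factorial : ℂ) /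
        (((m - 1).factorial * ∏ i, (α i).factorial : ℕ) : ℂ) := by
      rw [← sq, ← Complex.ofReal_pow, h2]; push_cast; rfl
    rw [← mul_assoc, h5]
    field_simp
  · rw [if_neg (Ne.symm h), if_neg h]; simp

theorem orthonormal_hardyMono (hm : 1 ≤ m) :
    Orthonormal ℂ (hardyMono : (Fin m → ℕ) → hardySpace m) := by
  classical
  rw [orthonormal_iff_ite]
  intro α β
  rw [inner_hardyMono hm]

theorem hardyPoly_mem_span (p : MvPolynomial (Fin m) ℂ) :
    hardyPoly m p ∈ Submodule.span ℂ (Set.range (hardyMono : (Fin m → ℕ) → hardySpace m)) := by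
  induction p using MvPolynomial.induction_on' with
  | monomial u a =>
    have h1 : MvPolynomial.monomial u a =
        (a * (monomialNormFactor (u : Fin m → ℕ) : ℂ)⁻¹) •
          (monomialNormFactor (u : Fin m → ℕ) : ℂ) • multiMonomial (u : Fin m → ℕ) := by
      have h2 : (monomialNormFactor (u : Fin m → ℕ) : ℂ) ≠ 0 := by
        exact_mod_cast (monomialNormFactor_pos _).ne'
      rw [smul_smul, mul_assoc, inv_mul_cancel₀ h2, mul_one, multiMonomial,
        MvPolynomial.smul_monomial]
      simp
    rw [h1, map_smul, map_smul]
    exact Submodule.smul_mem _ _ (Submodule.subset_span ⟨_, rfl⟩)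
  | add p q hp hq => rw [map_add]; exact Submodule.add_mem _ hp hq

/-- The Hilbert basis of normalized monomials of the Hardy space. -/
noncomputable def hardyBasis (hm : 1 ≤ m) : HilbertBasis (Fin m → ℕ) ℂ (hardySpace m) :=
  HilbertBasis.mk (orthonormal_hardyMono hm) (by
    intro x _
    rw [← SetLike.mem_coe, Submodule.topologicalClosure_coe]
    refine closure_mono ?_ (denseRange_hardyPoly x)
    rintro _ ⟨p, rfl⟩
    exact hardyPoly_mem_span p)

theorem hardyBasis_apply (hm : 1 ≤ m) (α : Fin m → ℕ) : hardyBasis hm α = hardyMono α := by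
  simp [hardyBasis]

theorem not_finiteDimensional_hardySpace (hm : 1 ≤ m) :
    ¬ FiniteDimensional ℂ (hardySpace m) := by
  intro h
  have : Nonempty (Fin m) := ⟨⟨0, hm⟩⟩
  have hf : Finite (Fin m → ℕ) := (orthonormal_hardyMono hm).linearIndependent.finite
  exact not_finite (Fin m → ℕ)

end HardyBasis

/-! ### The kernel `h_N` as a reproducing kernel -/

section ReproducingKernel

variable {m : ℕ}

/-- The sign `(-1)^{m-1}` cancels the one produced by differentiating in `1 - t`. The derivative
kills the `m - 1` lowest powers, so `N + 1` of the `N + m` terms survive. -/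
theorem hFun_one_sub (hm : 1 ≤ m) (N : ℕ) (u : ℂ) :
    hFun m N (1 - u) = 1 / (m : ℂ) * ∑ n ∈ Finset.range (N + 1),
      ((m - 1 + n).factorial : ℂ) / ((m - 1).factorial * n.factorial) * u ^ n := by
  have h1 : geomTrunc m N = fun t => (fun x : ℂ => ∑ j ∈ Finset.range (m - 1 + (N + 1)), x ^ j)
      (1 - t) := by
    funext t
    rw [geomTrunc, show N + m = m - 1 + (N + 1) by omega]
  have h2 : iteratedDeriv (m - 1) (fun x : ℂ => ∑ j ∈ Finset.range (m - 1 + (N + 1)), x ^ j) u =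
      ∑ n ∈ Finset.range (N + 1), ((m - 1 + n).factorial : ℂ) / n.factorial * u ^ n := by
    rw [iteratedDeriv_fun_sum (fun j _ => by fun_prop)]
    simp only [iteratedDeriv_pow]
    rw [Finset.sum_range_add, Finset.sum_eq_zero, zero_add]
    · refine Finset.sum_congr rfl fun n _ => ?_
      have h3 := Nat.factorial_mul_descFactorial (show m - 1 ≤ m - 1 + n by omega)
      rw [Nat.add_sub_cancel_left] at h3 ⊢
      have h4 : (n.factorial : ℂ) ≠ 0 := by exact_mod_cast Nat.factorial_ne_zero n
      congr 1
      rw [eq_div_iff h4, mul_comm]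
      exact_mod_cast h3
    · intro j hj
      rw [Nat.descFactorial_eq_zero_iff_lt.mpr (Finset.mem_range.mp hj)]
      simp
  have h0 := congrFun (iteratedDeriv_comp_const_sub (m - 1)
    (fun x : ℂ => ∑ j ∈ Finset.range (m - 1 + (N + 1)), x ^ j) 1) (1 - u)
  rw [hFun, h1, h0]
  simp only [sub_sub_cancel, smul_eq_mul]
  rw [h2, Finset.mul_sum, Finset.mul_sum, Finset.mul_sum]
  refine Finset.sum_congr rfl fun n _ => ?_
  have h3 : ((m.factorial : ℕ) : ℂ) = m * (m - 1).factorial := by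
    exact_mod_cast (Nat.mul_factorial_pred (by omega : m ≠ 0)).symm
  have h4 : ((-1 : ℂ) ^ (m - 1)) * (-1) ^ (m - 1) = 1 := by
    rw [← mul_pow]; simp
  have h5 : ((m - 1).factorial : ℂ) ≠ 0 := by exact_mod_cast Nat.factorial_ne_zero _
  have h6 : (n.factorial : ℂ) ≠ 0 := by exact_mod_cast Nat.factorial_ne_zero n
  have h7 : (m : ℂ) ≠ 0 := by exact_mod_cast (by omega : m ≠ 0)
  rw [h3]
  field_simp
  linear_combination ((m - 1 + n).factorial : ℂ) * u ^ n * h4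

/-- The multi-indices of total degree at most `N`. -/
def degreeLE (m N : ℕ) : Finset (Fin m → ℕ) :=
  (Fintype.piFinset fun _ => Finset.range (N + 1)).filter fun α => ∑ i, α i ≤ N

theorem mem_degreeLE {N : ℕ} {α : Fin m → ℕ} : α ∈ degreeLE m N ↔ ∑ i, α i ≤ N := by
  rw [degreeLE, Finset.mem_filter, Fintype.mem_piFinset]
  refine ⟨fun h => h.2, fun h => ⟨fun i => Finset.mem_range.mpr ?_, h⟩⟩
  have := Finset.single_le_sum (f := α) (fun _ _ => Nat.zero_le _) (Finset.mem_univ i)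
  omega

/-- The normalized monomial as a function on the sphere. -/
noncomputable def hardyMonoFun (α : Fin m → ℕ) (z : CSphere m) : ℂ :=
  (monomialNormFactor α : ℂ) * ∏ i, (z : CSpace m) i ^ α i

theorem continuous_hardyMonoFun (α : Fin m → ℕ) : Continuous (hardyMonoFun α) := by
  unfold hardyMonoFun
  fun_prop

/-- The multinomial theorem: in degree `n` the squared normalizing factors are the multinomial
coefficients times a constant depending only on `n` and `m`. -/
theorem sum_hardyMonoFun_piAntidiag (n : ℕ) (z w : CSphere m) :
    ∑ α ∈ Finset.piAntidiag Finset.univ n, star (hardyMonoFun α z) * hardyMonoFun α w =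
      ((m - 1 + n).factorial : ℂ) / ((m - 1).factorial * n.factorial) *
        (∑ i, star ((z : CSpace m) i) * (w : CSpace m) i) ^ n := by
  rw [Finset.sum_pow_eq_sum_piAntidiag, Finset.mul_sum]
  refine Finset.sum_congr rfl fun α hα => ?_
  have hα' : ∑ i, α i = n := (Finset.mem_piAntidiag.mp hα).1
  have h1 : (monomialNormFactor α : ℂ) * (monomialNormFactor α : ℂ) =
      ((m - 1 + n).factorial : ℂ) / ((m - 1).factorial * ∏ i, ((α i).factorial : ℂ)) := by
    rw [← sq, ← Complex.ofReal_pow, monomialNormFactor_sq, hα']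
    push_cast
    rfl
  have h2 : (∏ i, ((α i).factorial : ℂ)) * (Nat.multinomial Finset.univ α : ℂ) =
      (n.factorial : ℂ) := by
    have := Nat.multinomial_spec Finset.univ α
    rw [hα'] at this
    exact_mod_cast this
  have h3 : (∏ i, ((α i).factorial : ℂ)) ≠ 0 :=
    Finset.prod_ne_zero_iff.mpr fun i _ => by exact_mod_cast Nat.factorial_ne_zero _
  have h5 : ((m - 1).factorial : ℂ) ≠ 0 := by exact_mod_cast Nat.factorial_ne_zero _
  have h6 : (n.factorial : ℂ) ≠ 0 := by exact_mod_cast Nat.factorial_ne_zero n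
  simp only [hardyMonoFun, star_mul', star_prod, star_pow, Complex.star_def, Complex.conj_ofReal,
    mul_pow, Finset.prod_mul_distrib]
  calc _ = ((monomialNormFactor α : ℂ) * (monomialNormFactor α : ℂ)) *
        ((∏ i, (starRingEnd ℂ) ((z : CSpace m) i) ^ α i) * ∏ i, (w : CSpace m) i ^ α i) := by ring
    _ = _ := by
      rw [h1, ← h2]
      have h7 : (Nat.multinomial Finset.univ α : ℂ) ≠ 0 := by
        intro h0; rw [h0, mul_zero] at h2; exact h6 h2.symm
      field_simp

theorem hFun_eq_sum_hardyMonoFun (hm : 1 ≤ m) (N : ℕ) (z w : CSphere m) :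
    hFun m N (1 - ∑ i, star ((z : CSpace m) i) * (w : CSpace m) i) =
      1 / (m : ℂ) * ∑ α ∈ degreeLE m N, star (hardyMonoFun α z) * hardyMonoFun α w := by
  rw [hFun_one_sub hm, ← Finset.sum_fiberwise_of_maps_to (s := degreeLE m N)
    (t := Finset.range (N + 1)) (g := fun α => ∑ i, α i)
    (fun α hα => Finset.mem_range.mpr (Nat.lt_succ_of_le (mem_degreeLE.mp hα)))]
  congr 1
  refine Finset.sum_congr rfl fun n hn => ?_
  rw [← sum_hardyMonoFun_piAntidiag]
  refine Finset.sum_congr ?_ fun _ _ => rfl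
  ext α
  have := Finset.mem_range.mp hn
  simp only [Finset.mem_piAntidiag, Finset.mem_filter, mem_degreeLE, Finset.mem_univ,
    implies_true, and_true]
  change (∑ i, α i) = n ↔ _
  omega

theorem integral_kernel_mul_hardyMonoFun {G : hardySpace m →L[ℂ] hardySpace m}
    {k : CSphere m × CSphere m → ℂ} (hk : IsKernelOf k G) (α : Fin m → ℕ) :
    Integrable (fun x => k x * (star (hardyMonoFun α x.1) * hardyMonoFun α x.2))
      ((sphereVol m).prod (sphereVol m)) ∧
    ∫ x, k x * (star (hardyMonoFun α x.1) * hardyMonoFun α x.2)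
      ∂((sphereVol m).prod (sphereVol m)) = inner ℂ (hardyMono α) (G (hardyMono α)) := by
  have hki : Integrable k ((sphereVol m).prod (sphereVol m)) :=
    hk.1.integrable (by norm_num)
  have hcont : Continuous fun x : CSphere m × CSphere m =>
      star (hardyMonoFun α x.1) * hardyMonoFun α x.2 := by
    have := continuous_hardyMonoFun α
    fun_prop
  obtain ⟨C, hC⟩ : ∃ C, ∀ x : CSphere m × CSphere m,
      ‖star (hardyMonoFun α x.1) * hardyMonoFun α x.2‖ ≤ C :=
    ⟨_, (BoundedContinuousFunction.mkOfCompact ⟨_, hcont⟩).norm_coe_le_norm⟩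
  have hint : Integrable (fun x => k x * (star (hardyMonoFun α x.1) * hardyMonoFun α x.2))
      ((sphereVol m).prod (sphereVol m)) :=
    hki.mul_bdd hcont.aestronglyMeasurable (Eventually.of_forall hC)
  refine ⟨hint, ?_⟩
  rw [integral_prod _ hint, Submodule.coe_inner, L2.inner_def]
  refine integral_congr_ae ?_
  filter_upwards [hk.2 (hardyMono α), coeFn_hardyMono α] with z h1 h2
  rw [h1, h2]
  have h3 : ∫ w, k (z, w) * (hardyMono α : Lp ℂ 2 (sphereVol m)) w ∂(sphereVol m) =
      ∫ w, k (z, w) * hardyMonoFun α w ∂(sphereVol m) := by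
    refine integral_congr_ae ?_
    filter_upwards [coeFn_hardyMono α] with w hw
    rw [hw]; rfl
  rw [h3]
  change _ = (∫ w, k (z, w) * hardyMonoFun α w ∂(sphereVol m)) * star (hardyMonoFun α z)
  rw [← integral_mul_const]
  refine integral_congr_ae (Eventually.of_forall fun w => ?_)
  simp only
  ring

/-- The pairing of the kernel of `G` with `h_N` is the trace of `G` on the polynomials of degree
at most `N`, divided by `m`. -/
theorem kernelPairing_eq (hm : 1 ≤ m) {G : hardySpace m →L[ℂ] hardySpace m}
    {k : CSphere m × CSphere m → ℂ} (hk : IsKernelOf k G) (N : ℕ) :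
    kernelPairing k N =
      1 / (m : ℂ) * ∑ α ∈ degreeLE m N, inner ℂ (hardyMono α) (G (hardyMono α)) := by
  have h1 : ∀ x : CSphere m × CSphere m,
      k x * hFun m N (1 - ∑ i, star ((x.1 : CSpace m) i) * (x.2 : CSpace m) i) =
      1 / (m : ℂ) * ∑ α ∈ degreeLE m N,
        k x * (star (hardyMonoFun α x.1) * hardyMonoFun α x.2) := by
    intro x
    rw [hFun_eq_sum_hardyMonoFun hm, ← Finset.mul_sum]
    ring
  rw [kernelPairing]
  simp only [h1]
  rw [integral_const_mul, integral_finsetSum _ fun α _ => (integral_kernel_mul_hardyMonoFun hk α).1]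
  simp only [(integral_kernel_mul_hardyMonoFun hk _).2]

end ReproducingKernel

/-! ### The sub-Laplacian on holomorphic polynomials -/

section KohnLaplacian

variable {m : ℕ}

theorem hasFDerivAt_polyFun (p : MvPolynomial (Fin m) ℂ) (z : CSpace m) :
    HasFDerivAt (polyFun p) (∑ i, polyFun (MvPolynomial.pderiv i p) z •
      (EuclideanSpace.proj i : CSpace m →L[ℂ] ℂ)) z := by
  induction p using MvPolynomial.induction_on with
  | C a =>
    have h1 : (polyFun (MvPolynomial.C a) : CSpace m → ℂ) = fun _ => a := by
      funext z; simp [polyFun]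
    rw [h1]
    exact (hasFDerivAt_const (𝕜 := ℂ) a z).congr_fderiv (by ext v; simp [polyFun])
  | add p q hp hq =>
    have h1 : (polyFun (p + q) : CSpace m → ℂ) = fun z => polyFun p z + polyFun q z := by
      funext z; simp [polyFun]
    rw [h1]
    refine (hp.fun_add hq).congr_fderiv (ContinuousLinearMap.ext fun v => ?_)
    simp [polyFun, add_mul, Finset.sum_add_distrib]
  | mul_X p j hp =>
    have h1 : (polyFun (p * MvPolynomial.X j) : CSpace m → ℂ) = fun z => polyFun p z * z j := by
      funext z; simp [polyFun]
    rw [h1]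
    have h2 : HasFDerivAt (fun z : CSpace m => z j)
        (EuclideanSpace.proj j : CSpace m →L[ℂ] ℂ) z :=
      (EuclideanSpace.proj j : CSpace m →L[ℂ] ℂ).hasFDerivAt
    refine (hp.fun_mul h2).congr_fderiv (ContinuousLinearMap.ext fun v => ?_)
    simp only [polyFun, MvPolynomial.pderiv_mul, MvPolynomial.pderiv_X, map_add, map_mul,
      MvPolynomial.eval_X, sum_apply, smul_apply, add_apply, smul_eq_mul, add_mul,
      Finset.sum_add_distrib, Finset.mul_sum, Pi.single_apply]
    rw [add_comm]
    congr 1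
    · exact Finset.sum_congr rfl fun i _ => by ring
    · rw [Finset.sum_eq_single j]
      · simp
      · intro i _ hi; simp [Ne.symm hi]
      · simp

theorem hasFDerivAt_real_polyFun (p : MvPolynomial (Fin m) ℂ) (z : CSpace m) :
    HasFDerivAt (𝕜 := ℝ) (polyFun p) ((∑ i, polyFun (MvPolynomial.pderiv i p) z •
      (EuclideanSpace.proj i : CSpace m →L[ℂ] ℂ)).restrictScalars ℝ) z :=
  (hasFDerivAt_polyFun p z).restrictScalars ℝ

theorem sum_smul_proj_single (c : Fin m → ℂ) (k : Fin m) (a : ℂ) :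
    (∑ i, c i • (EuclideanSpace.proj i : CSpace m →L[ℂ] ℂ)) (EuclideanSpace.single k a) =
      c k * a := by
  simp [sum_apply]

theorem dz_polyFun (k : Fin m) (p : MvPolynomial (Fin m) ℂ) :
    dz k (polyFun p) = polyFun (MvPolynomial.pderiv k p) := by
  funext z
  rw [dz, (hasFDerivAt_real_polyFun p z).fderiv]
  simp only [ContinuousLinearMap.coe_restrictScalars', sum_smul_proj_single]
  linear_combination (-polyFun (MvPolynomial.pderiv k p) z / 2) * Complex.I_sq

theorem dzbar_polyFun (k : Fin m) (p : MvPolynomial (Fin m) ℂ) (z : CSpace m) :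
    dzbar k (polyFun p) z = 0 := by
  rw [dzbar, (hasFDerivAt_real_polyFun p z).fderiv]
  simp only [ContinuousLinearMap.coe_restrictScalars', sum_smul_proj_single]
  linear_combination (polyFun (MvPolynomial.pderiv k p) z / 2) * Complex.I_sq

theorem dzbar_star_mul_sub (k i j : Fin m) (p q : MvPolynomial (Fin m) ℂ) (z : CSpace m) :
    dzbar k (fun z => star (z i) * polyFun p z - star (z j) * polyFun q z) z =
      (if i = k then polyFun p z else 0) - if j = k then polyFun q z else 0 := by
  have hs (i : Fin m) : HasFDerivAt (𝕜 := ℝ) (fun z : CSpace m => star (z i))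
      ((Complex.conjCLE : ℂ →L[ℝ] ℂ) ∘L
        (EuclideanSpace.proj i : CSpace m →L[ℂ] ℂ).restrictScalars ℝ) z :=
    ((Complex.conjCLE : ℂ →L[ℝ] ℂ) ∘L
        (EuclideanSpace.proj i : CSpace m →L[ℂ] ℂ).restrictScalars ℝ).hasFDerivAt
  have h := ((hs i).fun_mul (hasFDerivAt_real_polyFun p z)).fun_sub
    ((hs j).fun_mul (hasFDerivAt_real_polyFun q z))
  rw [dzbar, HasFDerivAt.fderiv h]
  simp only [sub_apply, add_apply, smul_apply, ContinuousLinearMap.coe_restrictScalars',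
    sum_smul_proj_single, ContinuousLinearMap.comp_apply, smul_eq_mul]
  have e (i : Fin m) (a : ℂ) : (Complex.conjCLE : ℂ →L[ℝ] ℂ)
      ((EuclideanSpace.proj i : CSpace m →L[ℂ] ℂ) (EuclideanSpace.single k a)) =
      if i = k then star a else 0 := by
    by_cases h : i = k
    · subst h; simp
    · simp [h]
  rw [e, e, e, e]
  by_cases h1 : i = k <;> by_cases h2 : j = k <;> simp only [h1, h2, if_true, if_false] <;>
    simp only [Complex.star_def, Complex.conj_I, map_one] <;> ring_nf <;>
    simp only [Complex.I_sq] <;> ring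

/-- The field `M̄_{jk}` annihilates holomorphic functions, and in `M̄_{jk} M_{jk}` it differentiates
only the antiholomorphic coefficients, leaving `-(z_j ∂_j + z_k ∂_k)`. Each index lies in `m - 1`
pairs, so the result is `m - 1` times the Euler field. -/
theorem kohnLaplacian_polyFun (p : MvPolynomial (Fin m) ℂ) (z : CSpace m) :
    kohnLaplacian (polyFun p) z =
      ((m : ℂ) - 1) * ∑ i, z i * polyFun (MvPolynomial.pderiv i p) z := by
  set a : Fin m → ℂ := fun i => z i * polyFun (MvPolynomial.pderiv i p) z
  have h1 (j k : Fin m) (hjk : j < k) : tangM j k (tangMbar j k (polyFun p)) z +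
      tangMbar j k (tangM j k (polyFun p)) z = -(a j + a k) := by
    have e1 : tangMbar j k (polyFun p) = fun _ => 0 := by
      funext z; simp [tangMbar, dzbar_polyFun]
    have e2 : tangM j k (fun _ : CSpace m => (0 : ℂ)) z = 0 := by simp [tangM, dz]
    have e3 : tangM j k (polyFun p) = fun z => star (z j) * polyFun (MvPolynomial.pderiv k p) z -
        star (z k) * polyFun (MvPolynomial.pderiv j p) z := by
      funext z; simp only [tangM, dz_polyFun]
    rw [e1, e2, e3, tangMbar, dzbar_star_mul_sub, dzbar_star_mul_sub]
    simp only [hjk.ne, hjk.ne', if_true, if_false, a]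
    ring
  have h2 : kohnLaplacian (polyFun p) z = ∑ j : Fin m, ∑ k ∈ Finset.Ioi j, (a j + a k) := by
    rw [kohnLaplacian, ← Finset.sum_neg_distrib]
    refine Finset.sum_congr rfl fun j _ => ?_
    rw [← Finset.sum_neg_distrib]
    refine Finset.sum_congr rfl fun k hk => ?_
    rw [h1 j k (Finset.mem_Ioi.mp hk), neg_neg]
  have h3 : ∑ j : Fin m, ∑ k ∈ Finset.Ioi j, a k = ∑ k : Fin m, ∑ j ∈ Finset.Iio k, a k :=
    Finset.sum_comm' (by simp)
  rw [h2]
  simp only [Finset.sum_add_distrib]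
  rw [h3, ← Finset.sum_add_distrib, Finset.mul_sum]
  refine Finset.sum_congr rfl fun j _ => ?_
  rw [Finset.sum_const, Finset.sum_const, ← add_nsmul, Fin.card_Ioi, Fin.card_Iio, nsmul_eq_mul]
  have : ((m - 1 - (j : ℕ) + j : ℕ) : ℂ) = (m : ℂ) - 1 := by
    have hj := j.2
    rw [show m - 1 - (j : ℕ) + j = m - 1 by omega, Nat.cast_sub (by omega)]; simp
  rw [this]

theorem sum_mul_pderiv_multiMonomial (α : Fin m → ℕ) (z : CSpace m) :
    ∑ i, z i * polyFun (MvPolynomial.pderiv i (multiMonomial α)) z =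
      ((∑ i, α i : ℕ) : ℂ) * polyFun (multiMonomial α) z := by
  rw [Nat.cast_sum, Finset.sum_mul]
  refine Finset.sum_congr rfl fun i _ => ?_
  have h := congrArg (fun p => polyFun p z)
    (MvPolynomial.X_mul_pderiv_monomial (R := ℂ) (i := i)
      (m := Finsupp.equivFunOnFinite.symm α) (r := 1))
  simpa [polyFun, multiMonomial] using h

theorem resolvent_hardyMono {R : hardySpace m →L[ℂ] hardySpace m}
    (hR : IsSubLaplacianResolvent m R) (hm : 1 ≤ m) (α : Fin m → ℕ) :
    R (hardyMono α) = (((1 + ((m : ℝ) - 1) * (∑ i, α i : ℕ))⁻¹ : ℝ) : ℂ) • hardyMono α := by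
  set c : ℂ := 1 + ((m : ℂ) - 1) * (∑ i, α i : ℕ) with hc
  have hc0 : c ≠ 0 := by
    have h1 : (0 : ℝ) < 1 + ((m : ℝ) - 1) * (∑ i, α i : ℕ) := by
      have : (1 : ℝ) ≤ m := by exact_mod_cast hm
      have : 0 ≤ ((m : ℝ) - 1) * (∑ i, α i : ℕ) := mul_nonneg (by linarith) (by positivity)
      linarith
    rw [hc]
    exact_mod_cast h1.ne'
  have h := hR.2 (multiMonomial α) (c • hardyPoly m (multiMonomial α))
    (hardyPoly m (multiMonomial α)) ?_ (coeFn_hardyPoly _)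
  · rw [map_smul] at h
    have hv : R (hardyPoly m (multiMonomial α)) = c⁻¹ • hardyPoly m (multiMonomial α) := by
      rw [eq_inv_smul_iff₀ hc0]; exact h
    rw [hardyMono, map_smul, hv, smul_comm, hc]
    push_cast
    rfl
  · have h2 := Lp.coeFn_smul c (hardyPoly m (multiMonomial α) : Lp ℂ 2 (sphereVol m))
    filter_upwards [h2, coeFn_hardyPoly (multiMonomial α)] with z h3 h4
    rw [Submodule.coe_smul, h3, Pi.smul_apply, h4, kohnLaplacian_polyFun,
      sum_mul_pderiv_multiMonomial, smul_eq_mul, hc]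
    ring

end KohnLaplacian

/-! ### Functional calculus on eigenvectors -/

section FunctionalCalculus

variable {H : Type*} [NormedAddCommGroup H] [InnerProductSpace ℂ H] [CompleteSpace H]

/-- The claim holds for constants and the identity and is stable under sums, products and uniform
limits, so Stone–Weierstrass gives it for every continuous function on the spectrum. -/
theorem cfc_apply_eigenvector {T : H →L[ℂ] H} (hT : IsSelfAdjoint T) {x : H} (hx : x ≠ 0) {c : ℝ}
    (hc : T x = (c : ℂ) • x) {f : ℝ → ℝ} (hf : ContinuousOn f (spectrum ℝ T)) :
    cfc f T x = (f c : ℂ) • x := by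
  have hmem : c ∈ spectrum ℝ T := by
    intro h
    obtain ⟨u, hu⟩ := h
    have h1 : (u : H →L[ℂ] H) x = 0 := by
      rw [hu]
      simp [hc, Algebra.algebraMap_eq_smul_one]
    have h2 : ((↑u⁻¹ : H →L[ℂ] H) * (u : H →L[ℂ] H)) x = 0 := by
      rw [mul_apply_eq_comp, h1, map_zero]
    rw [Units.inv_mul] at h2
    exact hx h2
  rw [cfc_apply f T hT hf]
  suffices h : ∀ g : C(spectrum ℝ T, ℝ), cfcHom hT g x = (g ⟨c, hmem⟩ : ℂ) • x from
    h ⟨_, hf.domRestrict⟩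
  intro g
  induction g using ContinuousMap.induction_on_of_compact with
  | const r =>
    have : (ContinuousMap.const (spectrum ℝ T) r) = algebraMap ℝ _ r := rfl
    rw [this, AlgHomClass.commutes]
    simp [Algebra.algebraMap_eq_smul_one]
  | id =>
    rw [cfcHom_id (R := ℝ) hT, hc]
    rfl
  | star_id =>
    rw [star_trivial, cfcHom_id (R := ℝ) hT, hc]
    rfl
  | add f g hf hg => rw [map_add, add_apply, hf, hg]; simp [add_smul]
  | mul f g hf hg => 
    rw [map_mul, mul_apply_eq_comp, hg, map_smul, hf, ContinuousMap.mul_apply, Complex.ofReal_mul,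
      smul_smul, mul_comm]
  | frequently f hf =>
    have hcl : IsClosed {g : C(spectrum ℝ T, ℝ) | cfcHom hT g x = (g ⟨c, hmem⟩ : ℂ) • x} := by
      refine isClosed_eq ?_ ?_
      · exact (ContinuousLinearMap.apply ℂ H x).continuous.comp (cfcHom_continuous hT)
      · exact (Complex.continuous_ofReal.comp (continuous_eval_const (⟨c, hmem⟩ : spectrum ℝ T))).smul
          continuous_const
    exact hcl.mem_of_frequently_of_tendsto hf tendsto_id

theorem opPow_apply_eigenvector {T : H →L[ℂ] H} (hT : T.IsPositive) {x : H} (hx : x ≠ 0) {c : ℝ}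
    (hc : T x = (c : ℂ) • x) {s : ℝ} (hs : 0 < s) :
    opPow T s x = ((c ^ s : ℝ) : ℂ) • x := by
  have h1 : opPow T s = cfc (fun x : ℝ => x ^ s) T :=
    CFC.rpow_eq_cfc_real ((ContinuousLinearMap.nonneg_iff_isPositive T).mpr hT)
  rw [h1]
  exact cfc_apply_eigenvector hT.isSelfAdjoint hx hc
    (Real.continuous_rpow_const hs.le).continuousOn

end FunctionalCalculus

/-! ### Norm bounds for diagonal operators -/

section DiagonalOperators

variable {H : Type*} [NormedAddCommGroup H] [InnerProductSpace ℂ H] [CompleteSpace H]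

theorem norm_apply_le_of_hilbertBasis {ι : Type*} (b : HilbertBasis ι ℂ H) {V : H →L[ℂ] H}
    (hV : V.IsPositive) {c : ι → ℝ} (hb : ∀ i, V (b i) = (c i : ℂ) • b i) {ε : ℝ} (hε : 0 ≤ ε)
    {x : H} (h : ∀ i, inner ℂ (b i) x = 0 ∨ |c i| ≤ ε) : ‖V x‖ ≤ ε * ‖x‖ := by
  have h1 : ‖b.repr (V x)‖ ≤ ‖(ε : ℂ) • b.repr x‖ := by
    refine lp.norm_mono (by norm_num) fun i => ?_
    have h2 : inner ℂ (b i) (V x) = (c i : ℂ) * inner ℂ (b i) x := by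
      rw [show inner ℂ (b i) (V x) = inner ℂ (V (b i)) x from
        (hV.isSelfAdjoint.isSymmetric (b i) x).symm, hb, inner_smul_left, Complex.conj_ofReal]
    rw [lp.coeFn_smul, Pi.smul_apply, b.repr_apply_apply, b.repr_apply_apply, h2, norm_mul,
      norm_smul, Complex.norm_real, Complex.norm_real, Real.norm_of_nonneg hε, Real.norm_eq_abs]
    rcases h i with h3 | h3
    · rw [h3]; simp
    · gcongr
  rwa [norm_smul, LinearIsometryEquiv.norm_map, LinearIsometryEquiv.norm_map, Complex.norm_real,
    Real.norm_of_nonneg hε] at h1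

end DiagonalOperators

/-! ### Dimension of the polynomials of bounded degree -/

section DegreeCounting

theorem card_degreeLE_le (m N : ℕ) : (degreeLE m N).card ≤ (N + 1) ^ m := by
  refine (Finset.card_filter_le _ _).trans ?_
  simp

/-- The simplex contains the cube of multi-indices with entries at most `N / m`, and `N ≤ m (N / m +
1)`. -/
theorem pow_le_card_degreeLE {m : ℕ} (hm : 1 ≤ m) (N : ℕ) :
    N ^ m ≤ m ^ m * (degreeLE m N).card := by
  have h1 : (Fintype.piFinset fun _ : Fin m => Finset.range (N / m + 1)) ⊆ degreeLE m N := by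
    intro α hα
    rw [mem_degreeLE]
    rw [Fintype.mem_piFinset] at hα
    calc ∑ i, α i ≤ ∑ _i : Fin m, N / m :=
          Finset.sum_le_sum fun i _ => Nat.lt_succ_iff.mp (Finset.mem_range.mp (hα i))
      _ = m * (N / m) := by simp
      _ ≤ N := Nat.mul_div_le N m
  have h2 := Finset.card_le_card h1
  rw [Fintype.card_piFinset_const, Finset.card_range] at h2
  have h3 : N ≤ m * (N / m + 1) := (Nat.lt_mul_div_succ N (by omega)).le
  calc N ^ m ≤ (m * (N / m + 1)) ^ m := Nat.pow_le_pow_left h3 m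
    _ = m ^ m * (N / m + 1) ^ m := mul_pow _ _ _
    _ ≤ _ := Nat.mul_le_mul_left _ h2

theorem floor_rpow_inv_pow_le {m : ℕ} (hm : 1 ≤ m) (N : ℕ) :
    ⌊(N : ℝ) ^ (1 / (m : ℝ))⌋₊ ^ m ≤ N := by
  have h1 := Nat.floor_le (a := (N : ℝ) ^ (1 / (m : ℝ))) (by positivity)
  have h2 := pow_le_pow_left₀ (by positivity) h1 m
  rw [one_div, Real.rpow_inv_natCast_pow (by positivity) (by omega), ← one_div] at h2
  exact_mod_cast h2

theorem lt_floor_rpow_inv_add_one_pow {m : ℕ} (hm : 1 ≤ m) (N : ℕ) :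
    N < (⌊(N : ℝ) ^ (1 / (m : ℝ))⌋₊ + 1) ^ m := by
  have h1 := Nat.lt_floor_add_one ((N : ℝ) ^ (1 / (m : ℝ)))
  have h2 := pow_lt_pow_left₀ h1 (by positivity) (by omega : m ≠ 0)
  rw [one_div, Real.rpow_inv_natCast_pow (by positivity) (by omega), ← one_div] at h2
  exact_mod_cast h2

theorem floor_pow_rpow_inv {m : ℕ} (hm : 1 ≤ m) (N : ℕ) :
    ⌊((N ^ m : ℕ) : ℝ) ^ (1 / (m : ℝ))⌋₊ = N := by
  rw [one_div, Nat.cast_pow, Real.pow_rpow_inv_natCast (by positivity) (by omega),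
    Nat.floor_natCast]

end DegreeCounting

/-! ### Trace asymptotics for sub-Laplacian modulated operators -/

section SubLaplacian

variable {m : ℕ}

theorem subLaplacian_eigenvalue_antitone (hm : 1 ≤ m) {s : ℝ} (hs : 0 ≤ s) {a b : ℕ}
    (hab : a ≤ b) :
    ((1 + ((m : ℝ) - 1) * b)⁻¹) ^ s ≤ ((1 + ((m : ℝ) - 1) * a)⁻¹) ^ s := by
  have h1 : (0 : ℝ) ≤ (m : ℝ) - 1 := by
    have : (1 : ℝ) ≤ m := by exact_mod_cast hm
    linarith
  have h2 : (a : ℝ) ≤ b := by exact_mod_cast hab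
  gcongr

theorem subLaplacian_eigenvalue_nonneg (hm : 1 ≤ m) (s : ℝ) (a : ℕ) :
    0 ≤ ((1 + ((m : ℝ) - 1) * a)⁻¹) ^ s := by
  have h1 : (0 : ℝ) ≤ (m : ℝ) - 1 := by
    have : (1 : ℝ) ≤ m := by exact_mod_cast hm
    linarith
  positivity

theorem opPow_resolvent_hardyMono (hm : 1 ≤ m) {R : hardySpace m →L[ℂ] hardySpace m}
    (hR : IsSubLaplacianResolvent m R) {s : ℝ} (hs : 0 < s) (α : Fin m → ℕ) :
    opPow R s (hardyMono α) =
      (((1 + ((m : ℝ) - 1) * (∑ i, α i : ℕ))⁻¹ ^ s : ℝ) : ℂ) • hardyMono α :=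
  opPow_apply_eigenvector hR.1 ((orthonormal_hardyMono hm).ne_zero α)
    (resolvent_hardyMono hR hm α) hs

theorem norm_opPow_resolvent_le (hm : 1 ≤ m) {R : hardySpace m →L[ℂ] hardySpace m}
    (hR : IsSubLaplacianResolvent m R) {s : ℝ} (hs : 0 < s) (hV : (opPow R s).IsPositive) (n : ℕ)
    {x : hardySpace m} (hx : ∀ α ∈ degreeLE m n, inner ℂ (hardyMono α) x = 0) :
    ‖opPow R s x‖ ≤ ((1 + ((m : ℝ) - 1) * (n + 1 : ℕ))⁻¹) ^ s * ‖x‖ := by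
  refine norm_apply_le_of_hilbertBasis (hardyBasis hm) hV
    (c := fun α => (1 + ((m : ℝ) - 1) * (∑ i, α i : ℕ))⁻¹ ^ s)
    (fun α => by rw [hardyBasis_apply]; exact opPow_resolvent_hardyMono hm hR hs α)
    (subLaplacian_eigenvalue_nonneg hm s (n + 1)) fun α => ?_
  rw [hardyBasis_apply]
  by_cases h : ∑ i, α i ≤ n
  · exact Or.inl (hx α (mem_degreeLE.mpr h))
  · right
    rw [abs_of_nonneg (subLaplacian_eigenvalue_nonneg hm s _)]
    exact subLaplacian_eigenvalue_antitone hm hs.le (by omega)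

/-- Turns membership of `V` in a weak Schatten ideal into decay of its eigenvalues, with no need to
relate `p` to `s` and `m`. -/
theorem subLaplacian_eigenvalue_le_singVal (hm : 1 ≤ m) {R : hardySpace m →L[ℂ] hardySpace m}
    (hR : IsSubLaplacianResolvent m R) {s : ℝ} (hs : 0 < s) {n k : ℕ}
    (hk : (degreeLE m n).card = k + 1) :
    ((1 + ((m : ℝ) - 1) * n)⁻¹) ^ s ≤ singVal k (opPow R s) := by
  set e := (degreeLE m n).equivFinOfCardEq hk
  refine le_singVal_of_orthonormal_eigenvectors
    (e := fun i => hardyMono (e.symm i : Fin m → ℕ))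
    ((orthonormal_hardyMono hm).comp _ (Subtype.val_injective.comp e.symm.injective))
    (fun i => opPow_resolvent_hardyMono hm hR hs _) fun i => ?_
  rw [Complex.norm_real, Real.norm_of_nonneg (subLaplacian_eigenvalue_nonneg hm s _)]
  exact subLaplacian_eigenvalue_antitone hm hs.le (mem_degreeLE.mp (e.symm i).2)

/-- The trace of a weakly sub-Laplacian modulated operator on the polynomials of degree at most
`N ^ (1 / m)` is the sum of its first singular values, up to a bounded error. -/
theorem exists_norm_sum_degreeLE_sub_le (hm : 1 ≤ m) {G : hardySpace m →L[ℂ] hardySpace m}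
    (hG : IsWeakSchatten 1 G) (hmod : IsWeaklySubLaplacianModulated m G) :
    ∃ E : ℝ, ∀ N : ℕ, 1 ≤ N →
      ‖∑ α ∈ degreeLE m ⌊(N : ℝ) ^ (1 / (m : ℝ))⌋₊, inner ℂ (hardyMono α) (G (hardyMono α)) -
        partsSingSum G (N + 1)‖ ≤ E := by
  obtain ⟨R, hR, s, hs, hV, -, p, hp, ⟨-, C, hC⟩, A, hAV, hA⟩ := hmod
  have hp0 : 0 < p := by linarith
  have hC0 : 0 ≤ C := by simpa using (singVal_nonneg 0 _).trans (hC 0)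
  obtain ⟨D, hD, hDb⟩ := exists_norm_diagonal_sub_le (not_finiteDimensional_hardySpace hm) hG hp hA
    hAV
  refine ⟨D * (2 ^ m + C * ((m : ℝ) ^ m) ^ (1 / p) + 1), fun N hN => ?_⟩
  set n := ⌊(N : ℝ) ^ (1 / (m : ℝ))⌋₊ with hn
  have hn1 : n ^ m ≤ N := floor_rpow_inv_pow_le hm N
  have hn2 : N < (n + 1) ^ m := lt_floor_rpow_inv_add_one_pow hm N
  have hn0 : 1 ≤ n := by
    by_contra h
    have : n = 0 := by omega
    rw [this] at hn2
    simp at hn2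
    omega
  -- The eigenvalue of `V` at degree `n + 1`, the first degree outside the range of the projection.
  set ε : ℝ := ((1 + ((m : ℝ) - 1) * (n + 1 : ℕ))⁻¹) ^ s with hε
  have hε0 : 0 ≤ ε := subLaplacian_eigenvalue_nonneg hm s (n + 1)
  have hb := hDb (N + 1) (ι := degreeLE m n) (fun α => hardyMono (α : Fin m → ℕ)) ε
    ((orthonormal_hardyMono hm).comp _ Subtype.val_injective)
    (fun x hx => norm_opPow_resolvent_le hm hR hs hV n fun α hα =>
      (span_orthogonal_iff _ _).mp hx ⟨α, hα⟩) hε0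
  rw [Finset.sum_coe_sort (degreeLE m n)
    (fun α => inner ℂ (hardyMono α) (G (hardyMono α)))] at hb
  refine hb.trans (mul_le_mul_of_nonneg_left ?_ hD)
  have h1 : (Fintype.card (degreeLE m n) : ℝ) / (1 + ((N + 1 : ℕ) : ℝ)) ≤ 2 ^ m := by
    rw [div_le_iff₀ (by positivity), Fintype.card_coe]
    have h2 : (degreeLE m n).card ≤ 2 ^ m * (1 + (N + 1)) := by
      calc (degreeLE m n).card ≤ (n + 1) ^ m := card_degreeLE_le m n
        _ ≤ (2 * n) ^ m := Nat.pow_le_pow_left (by omega) m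
        _ = 2 ^ m * n ^ m := mul_pow _ _ _
        _ ≤ 2 ^ m * (1 + (N + 1)) := Nat.mul_le_mul_left _ (by omega)
    exact_mod_cast h2
  -- With `M` the dimension up to degree `n + 1`, the decay of singular values gives `ε ≤ C
  -- M^{-1/p}`, and `N + 1 ≤ m^m M` because `N < (n + 1)^m`.
  have h3 : ((N + 1 : ℕ) : ℝ) ^ (1 / p) * ε ≤ C * ((m : ℝ) ^ m) ^ (1 / p) := by
    set M := (degreeLE m (n + 1)).card with hM
    have hM1 : N + 1 ≤ m ^ m * M := hn2.trans_le (pow_le_card_degreeLE hm (n + 1))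
    have hM0 : 0 < M := by
      rcases Nat.eq_zero_or_pos M with h | h
      · rw [h] at hM1; omega
      · exact h
    have h4 : ε ≤ C * (M : ℝ) ^ (-(1 / p)) := by
      have h5 := (subLaplacian_eigenvalue_le_singVal hm hR hs (n := n + 1) (k := M - 1)
        (by omega)).trans (hC (M - 1))
      have h6 : (1 + ((M - 1 : ℕ) : ℝ)) = M := by
        rw [Nat.cast_sub hM0]; simp
      rwa [h6] at h5
    have h7 : ((N + 1 : ℕ) : ℝ) ^ (1 / p) ≤ ((m : ℝ) ^ m) ^ (1 / p) * (M : ℝ) ^ (1 / p) := by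
      rw [← Real.mul_rpow (by positivity) (by positivity)]
      exact Real.rpow_le_rpow (by positivity) (by exact_mod_cast hM1) (by positivity)
    have hMp : (0 : ℝ) < M := by exact_mod_cast hM0
    have h8 : (M : ℝ) ^ (1 / p) * (M : ℝ) ^ (-(1 / p)) = 1 := by
      rw [← Real.rpow_add hMp]; simp
    calc ((N + 1 : ℕ) : ℝ) ^ (1 / p) * ε
        ≤ (((m : ℝ) ^ m) ^ (1 / p) * (M : ℝ) ^ (1 / p)) * (C * (M : ℝ) ^ (-(1 / p))) := by
          gcongr
      _ = C * ((m : ℝ) ^ m) ^ (1 / p) * ((M : ℝ) ^ (1 / p) * (M : ℝ) ^ (-(1 / p))) := by ring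
      _ = _ := by rw [h8, mul_one]
  linarith

end SubLaplacian

/-! ### The two trace formulas -/

theorem mainTheorem11 (m : ℕ) (hm : 2 ≤ m) (G : hardySpace m →L[ℂ] hardySpace m)
    (hG : IsWeakSchatten 1 G) (hmod : IsWeaklySubLaplacianModulated m G)
    (k : CSphere m × CSphere m → ℂ) (hk : IsKernelOf k G)
    (ω : EllInfty →L[ℂ] ℂ) (hω : IsExtendedLimit ω) :
    (∃ h : Memℓp (fun N : ℕ =>
          (m : ℂ) / (Real.log N : ℂ) * kernelPairing k ⌊(N : ℝ) ^ (1 / (m : ℝ))⌋₊) ∞,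
        dixmierTrace ω G = ω ⟨_, h⟩) ∧
      ∃ h : Memℓp (fun N : ℕ => 1 / (Real.log N : ℂ) * kernelPairing k N) ∞,
        IsPowInvariant m ω → dixmierTrace ω G = ω ⟨_, h⟩ := by
  have hm1 : 1 ≤ m := by omega
  have hm0 : (m : ℂ) ≠ 0 := by exact_mod_cast (by omega : m ≠ 0)
  obtain ⟨E, hE⟩ := exists_norm_sum_degreeLE_sub_le hm1 hG hmod
  have hseq : (fun N : ℕ => (m : ℂ) / (Real.log N : ℂ) *
      kernelPairing k ⌊(N : ℝ) ^ (1 / (m : ℝ))⌋₊) = fun N : ℕ =>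
      (∑ α ∈ degreeLE m ⌊(N : ℝ) ^ (1 / (m : ℝ))⌋₊, inner ℂ (hardyMono α) (G (hardyMono α))) /
        (Real.log N : ℂ) := by
    funext N
    rw [kernelPairing_eq hm1 hk]
    field_simp
  have hfirst : ∃ h : Memℓp (fun N : ℕ =>
      (m : ℂ) / (Real.log N : ℂ) * kernelPairing k ⌊(N : ℝ) ^ (1 / (m : ℝ))⌋₊) ∞,
      dixmierTrace ω G = ω ⟨_, h⟩ := by
    rw [hseq]
    exact dixmierTrace_eq_of_norm_sub_le (not_finiteDimensional_hardySpace hm1) hG hω hE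
  refine ⟨hfirst, ?_⟩
  obtain ⟨h, htr⟩ := hfirst
  -- At `N ^ m` the root is exactly `N` and `log (N ^ m) = m log N` absorbs the factor `m`. The
  -- second sequence is thus a subsequence of the first, which gives its boundedness too.
  have hsub : ∀ N : ℕ, 1 / (Real.log N : ℂ) * kernelPairing k N =
      (⟨_, h⟩ : EllInfty) (N ^ m) := by
    intro N
    change _ = (m : ℂ) / (Real.log (N ^ m : ℕ) : ℂ) *
      kernelPairing k ⌊((N ^ m : ℕ) : ℝ) ^ (1 / (m : ℝ))⌋₊
    rw [floor_pow_rpow_inv hm1, Nat.cast_pow, Real.log_pow]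
    push_cast
    rw [← div_div, div_self hm0]
  have hmem : Memℓp (fun N : ℕ => 1 / (Real.log N : ℂ) * kernelPairing k N) ∞ := by
    refine memℓp_infty ⟨‖(⟨_, h⟩ : EllInfty)‖, ?_⟩
    rintro _ ⟨N, rfl⟩
    simp only [hsub]
    exact lp.norm_apply_le_norm (by simp) (⟨_, h⟩ : EllInfty) (N ^ m)
  exact ⟨hmem, fun hpow => htr.trans (hpow ⟨_, h⟩ ⟨_, hmem⟩ hsub).symm⟩
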